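/- Let $K$ be a number field with ring of integers $\mathcal{O}_K$. For a prime (nonzero prime ideal) $\mathfrak{p}$ of $\mathcal{O}_K$ let $v_{\mathfrak p}\colon K\to\mathbb{Z}\cup\{\infty\}$ be the normalised additive $\mathfrak p$-adic valuation, and for a polynomial $g\in K[x]$ let $\Delta(g)$ denote its discriminant. Write $f^n$ for the $n$-th iterate of a polynomial $f$ under composition ($f^0=x$), $f^{-n}(x_0)=\{\alpha\in\overline{K} : f^n(\alpha)=x_0\}$, and $[S_d]^n$ for the $n$-fold iterated wreath product of the symmetric group $S_d$ acting on $d$ letters, that is, $[S_d]^0=1$ and $[S_d]^{n+1}=\big([S_d]^n\big)^d\rtimes S_d$ with $S_d$ permuting the $d$ factors. **Theorem 3.1.** Fix integers $d>m\geq 2$ with $\gcd(m,d)=1$ and $m>d/2$. Let $b,x_0\in K$ be such that $x_0=s/t$ and $b=u/w$ with $s,t,u,w\in\mathcal{O}_K$, $t,w\neq 0$, where $s\mathcal{O}_K+t\mathcal{O}_K=\mathcal{O}_K$ and $u\mathcal{O}_K+w\mathcal{O}_K=\mathcal{O}_K$. Suppose that the polynomial $f(x)=x^d-bx^m$ satisfies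 the following properties. 1. There is a prime $\mathfrak{p}_1$ of $\mathcal{O}_K$ with $v_{\mathfrak{p}_1}(b)\geq 1$ and $v_{\mathfrak{p}_1}(x_0)=1$. 2. There is a prime $\mathfrak{p}_2$ of $\mathcal{O}_K$ such that $\mathfrak{p}_2\nmid (d-m)$, $v_{\mathfrak{p}_2}(b)<\min\{v_{\mathfrak{p}_2}(x_0),0\}$, $(d-m)\mid v_{\mathfrak{p}_2}(b)$, and $\gcd\big(m,v_{\mathfrak{p}_2}(x_0/b)\big)=1$. 3. For each $n\geq 1$ there is a prime $\mathfrak{p}$ of $\mathcal{O}_K$ with $\mathfrak{p}\nmid stuwd(d-m)$ such that $v_{\mathfrak p}\big(\Delta(f^n(x)-x_0)\big)$ is positive and odd, and $v_{\mathfrak p}\big(\Delta(f^{\ell}(x)-x_0)\big)=0$ for all $0\leq \ell<n$. Then for all $n\geq 0$, $$\mathrm{Gal}\Big(K\big(f^{-n}(x_0)\big)/K\Big)\cong [S_d]^n .$$ -/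

import Mathlib

open Polynomial
open scoped NumberField

namespace Arboreal

/-- The additive `𝔭`-adic valuation `v_𝔭 : K → ℤ ∪ {∞}` of a number field `K` at a prime `𝔭`
of its ring of integers, normalised to have value group `ℤ` on `Kˣ`, with `v_𝔭(0) = ∞`.
Mathlib's multiplicative valuation is `exp (-v_𝔭(x))`. -/
noncomputable def ord {K : Type*} [Field K] [NumberField K]
    (p : IsDedekindDomain.HeightOneSpectrum (𝓞 K)) (x : K) : WithTop ℤ :=
  open Classical in
  if x = 0 then ⊤ else ((-WithZero.log (p.valuation K x) : ℤ) : WithTop ℤ)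

/-- The `n`-th iterate `f ∘ f ∘ ⋯ ∘ f` of a polynomial, with `f^0 = X`. -/
noncomputable def iter {K : Type*} [Field K] (f : K[X]) (n : ℕ) : K[X] :=
  f.comp^[n] X

/-- The set `f^{-n}(x₀)` of `n`-th preimages of `x₀` in the algebraic closure of `K`. -/
def preimages {K : Type*} [Field K] (f : K[X]) (x₀ : K) (n : ℕ) :
    Set (AlgebraicClosure K) :=
  {α | aeval α (iter f n) = algebraMap K (AlgebraicClosure K) x₀}

/-- The field `K(f^{-n}(x₀))`. -/
noncomputable def preimageField {K : Type*} [Field K] (f : K[X]) (x₀ : K) (n : ℕ) :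
    IntermediateField K (AlgebraicClosure K) :=
  IntermediateField.adjoin K (preimages f x₀ n)

/-- The `n`-fold wreath product `[S_d]^n` of the symmetric group `S_d` with itself, with respect
to its natural action on `d` letters: `[S_d]^0` is trivial and
`[S_d]^{n+1} = [S_d]^n ≀ S_d = ([S_d]^n)^d ⋊ S_d`, where `S_d` permutes the `d` factors. -/
def wreathSym (d : ℕ) : ℕ → GrpCat.{0}
  | 0 => GrpCat.of PUnit
  | n + 1 => GrpCat.of ((Fin d → wreathSym d n) ⋊[mulAutArrow] Equiv.Perm (Fin d))

end Arboreal

namespace Arboreal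
open IsDedekindDomain WithZero

/-! ### Inertia groups and extensions of valuations -/

section Inertia

variable {K L : Type*} [Field K] [Field L] [NumberField L] [Algebra K L]

/-! Put L = K(f^{-n}(x₀)). The Galois group acts faithfully on the tree of preimages of x₀ up to
height n, whose automorphism group is [S_d]^n once each level i has d^i points. So every tree
automorphism must be realised. Two automorphisms of height i+1 with the same restriction to height i
differ by a permutation preserving each fiber of f, and this is a product of transpositions inside
fibers. Hence it suffices that Galois induces all such transpositions on each level
(`exists_galois_of_tree_perm`).

The group elements come from inertia at three kinds of primes. At 𝔭₁ the polynomials f^i − x₀ are of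
Eisenstein type, so inertia is transitive on full levels (`level_transitive`). At 𝔭₂ the Newton
polygon of f − α separates m small roots from d − m others. For a suitable α, inertia elements carry
any small root to any other and fix the rest of the fiber (`exists_transitive_on_part`). At a prime
of condition (3) the odd discriminant makes inertia nontrivial, while only one pair of points can
collide under reduction, so a transposition appears (`exists_transposition`).

Group theory finishes (`swap_mem_of_fiber`). The relation "(x y) lies in the group" is an invariant
equivalence relation whose classes have a common size k ≥ 2 and lie in fibers. If the m small roots
form a union of classes, then k divides both m and d, which are coprime. Otherwise some class
contains all of them and one more point, so k > m > d/2 and the class is the whole fiber. -/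

theorem valuation_smul_sub_lt_one (Q : HeightOneSpectrum (𝓞 L)) (σ : Gal(L/K))
    (hσ : σ ∈ Q.asIdeal.inertia Gal(L/K)) (x : L) (hx : Q.valuation L x ≤ 1) :
    Q.valuation L (σ x - x) < 1 := by
  -- Write x = a/s with s outside Q; then σ(s)(σx − x) = (σa − a) − (σs − s)x reduces the claim to
  -- integers.
  obtain ⟨a, ⟨s, hs⟩, h⟩ := Q.exists_primeCompl_mul_eq_of_integer x hx
  have hval : ∀ t : 𝓞 L, Q.valuation L (σ (t : L) - t) < 1 := by
    intro t
    have h1 : σ (t : L) - t = algebraMap (𝓞 L) L (σ • t - t) := by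
      rfl
    rw [h1, HeightOneSpectrum.valuation_lt_one_iff_mem]
    exact hσ t
  have hs1 : Q.valuation L (s : L) = 1 := by
    refine le_antisymm (Q.valuation_le_one s) (not_lt.1 fun h' => hs ?_)
    exact (HeightOneSpectrum.valuation_lt_one_iff_mem _ _).1 h'
  have hσs : Q.valuation L (σ (s : L)) = 1 := by
    have := hval s
    have h2 := Valuation.map_add_eq_of_lt_right (Q.valuation L) (x := σ (s : L) - s) (y := (s : L))
      (by rw [hs1]; exact this)
    rw [sub_add_cancel, hs1] at h2
    exact h2
  have h3 : σ (s : L) * (σ x - x) = (σ (a : L) - a) - (σ (s : L) - s) * x := by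
    have h' : (s : L) * x = a := (mul_comm _ _).trans h
    rw [← h', map_mul]; ring
  have h4 : Q.valuation L (σ (s : L) * (σ x - x)) < 1 := by
    rw [h3]
    refine lt_of_le_of_lt (Valuation.map_sub _ _ _) (max_lt (hval a) ?_)
    rw [map_mul]
    exact mul_lt_one_of_nonneg_of_lt_one_left zero_le (hval s) hx
  rwa [map_mul, hσs, one_mul] at h4

variable [NumberField K]

/-- The order of an inertia group is the ramification exponent of valuations. -/
theorem valuation_algebraMap_eq_pow_card_inertia {G : Type*} [Group G] [Finite G]
    [MulSemiringAction G (𝓞 L)] [IsGaloisGroup G (𝓞 K) (𝓞 L)]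
    (p : HeightOneSpectrum (𝓞 K)) (Q : HeightOneSpectrum (𝓞 L))
    [Q.asIdeal.LiesOver p.asIdeal] (x : K) :
    Q.valuation L (algebraMap K L x) = p.valuation K x ^ Nat.card (Q.asIdeal.inertia G) := by
  have : Finite (𝓞 K ⧸ p.asIdeal) := Ring.HasFiniteQuotients.finiteQuotient p.ne_bot
  have := p.isMaximal
  rw [Ideal.card_inertia_eq_ramificationIdxIn p.asIdeal Q.asIdeal,
    Ideal.ramificationIdxIn_eq_ramificationIdx p.asIdeal Q.asIdeal G,
    ← Ideal.ramificationIdx'_eq_ramificationIdx p.asIdeal Q.asIdeal p.ne_bot,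
    HeightOneSpectrum.valuation_liesOver L p Q]

/-- The inertia group of Q over the fixed field of I is I itself, so the ramification index over
that field is |I|. -/
theorem exists_pow_of_fixed_by_inertia [IsGalois K L] (Q : HeightOneSpectrum (𝓞 L)) (x : L)
    (hx : ∀ σ ∈ Q.asIdeal.inertia Gal(L/K), σ x = x) :
    ∃ z : ℤᵐ⁰, Q.valuation L x = z ^ Nat.card (Q.asIdeal.inertia Gal(L/K)) := by
  set I := Q.asIdeal.inertia Gal(L/K) with hI
  let E : IntermediateField K L := FixedPoints.intermediateField I
  have h1 : IsGaloisGroup I E L := IsGaloisGroup.subgroup Gal(L/K) K L I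
  have h2 : IsGaloisGroup I (𝓞 E) (𝓞 L) := .of_isFractionRing _ _ _ E L
  have hne : Q.asIdeal.under (𝓞 E) ≠ ⊥ := Ideal.IsIntegral.comap_ne_bot _ Q.ne_bot
  let q : HeightOneSpectrum (𝓞 E) := ⟨Q.asIdeal.under (𝓞 E), inferInstance, hne⟩
  have : Q.asIdeal.LiesOver q.asIdeal := ⟨rfl⟩
  have hxE : x ∈ E := fun σ => hx σ.1 σ.2
  refine ⟨q.valuation E ⟨x, hxE⟩, ?_⟩
  have key := valuation_algebraMap_eq_pow_card_inertia (G := I) q Q (⟨x, hxE⟩ : E)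
  have htop : Q.asIdeal.inertia I = ⊤ := by
    ext σ
    simp only [Subgroup.mem_top, iff_true]
    rw [← Ideal.coe_mem_inertia]
    exact σ.2
  rw [htop, Subgroup.card_top] at key
  exact key

/-- For every prime of `K` there is a valuation on `L` extending it, with ramification index `e`
and an inertia group `I`: the fixed field of `I` has ramification index `1` below. -/
theorem exists_valuation_inertia (L : Type*) [Field L] [NumberField L] [Algebra K L] [IsGalois K L]
    (p : HeightOneSpectrum (𝓞 K)) :
    ∃ (v : Valuation L ℤᵐ⁰) (e : ℕ) (I : Subgroup Gal(L/K)), e ≠ 0 ∧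
      (∀ x : K, v (algebraMap K L x) = p.valuation K x ^ e) ∧
      (∀ x : L, (∀ σ ∈ I, σ x = x) → ∃ z : ℤᵐ⁰, v x = z ^ e) ∧
      (∀ σ ∈ I, ∀ x : L, v x ≤ 1 → v (σ x - x) < 1) := by
  obtain ⟨⟨Q, hQ, hQp⟩⟩ := Ideal.nonempty_primesOver (S := 𝓞 L) p.asIdeal
  let Q : HeightOneSpectrum (𝓞 L) := ⟨Q, hQ, Ideal.ne_bot_of_liesOver_of_ne_bot p.ne_bot Q⟩
  have : Q.asIdeal.LiesOver p.asIdeal := hQp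
  exact ⟨Q.valuation L, _, Q.asIdeal.inertia Gal(L/K), Nat.card_pos.ne',
    valuation_algebraMap_eq_pow_card_inertia p Q, exists_pow_of_fixed_by_inertia Q,
    valuation_smul_sub_lt_one Q⟩

/-- A set of elements of `L` that is stable under inertia, has at most `N` elements, and whose
elements have valuation `1/N` times that of an element of `K` of valuation prime to `N`, is a single
orbit with exactly `N` elements. -/
theorem inertia_transitive {p : HeightOneSpectrum (𝓞 K)} {v : Valuation L ℤᵐ⁰} {e : ℕ}
    {I : Subgroup Gal(L/K)} (he : e ≠ 0)
    (hK : ∀ x : K, v (algebraMap K L x) = p.valuation K x ^ e)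
    (hfix : ∀ x : L, (∀ σ ∈ I, σ x = x) → ∃ z : ℤᵐ⁰, v x = z ^ e)
    {N : ℕ} (S : Finset L) (hS : ∀ σ ∈ I, ∀ y ∈ S, σ y ∈ S) (hcard : S.card ≤ N)
    {a : K} (hv : ∀ y ∈ S, v y ^ N = v (algebraMap K L a))
    {k : ℤ} (hk : p.valuation K a = exp k) (hNk : IsCoprime (N : ℤ) k) {y : L} (hy : y ∈ S) :
    S.card = N ∧ ∀ y' ∈ S, ∃ σ ∈ I, σ y = y' := by
  classical
  set O := S.filter (fun y' => ∃ σ ∈ I, σ y = y') with hO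
  have hOS : O ⊆ S := Finset.filter_subset _ _
  have hyO : y ∈ O := Finset.mem_filter.2 ⟨hy, 1, I.one_mem, rfl⟩
  have hstab : ∀ σ ∈ I, ∀ z ∈ O, σ z ∈ O := by
    intro σ hσ z hz
    obtain ⟨hz1, τ, hτ, rfl⟩ := Finset.mem_filter.1 hz
    exact Finset.mem_filter.2 ⟨hS σ hσ _ hz1, σ * τ, I.mul_mem hσ hτ, rfl⟩
  have hinv : ∀ σ ∈ I, σ (∏ z ∈ O, z) = ∏ z ∈ O, z := by
    intro σ hσ
    rw [map_prod]
    refine Finset.prod_nbij (fun z => σ z) (fun z hz => hstab σ hσ z hz)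
      σ.injective.injOn (fun z hz => ⟨σ⁻¹ z, hstab _ (I.inv_mem hσ) z hz, ?_⟩) (fun _ _ => rfl)
    exact (AlgEquiv.mul_apply _ _ _).symm.trans (by simp)
  -- The product over the orbit O is fixed by inertia, so its value is an e-th power. Comparing with
  -- the value of a gives N ∣ |O|·k, hence N ∣ |O|.
  obtain ⟨z, hz⟩ := hfix _ hinv
  have h1 : (z ^ N) ^ e = (exp k ^ O.card) ^ e := by
    rw [pow_right_comm, ← hz, map_prod, ← Finset.prod_pow,
      Finset.prod_congr rfl (fun z hz => hv z (hOS hz)), Finset.prod_const, hK, hk, pow_right_comm]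
  have h2 : z ^ N = exp k ^ O.card := (pow_left_inj₀ zero_le zero_le he).1 h1
  have hO0 : 0 < O.card := Finset.card_pos.2 ⟨y, hyO⟩
  have hN0 : N ≠ 0 := by
    have := Finset.card_le_card hOS
    omega
  have hz0 : z ≠ 0 := by
    rintro rfl
    rw [zero_pow hN0] at h2
    exact pow_ne_zero _ exp_ne_zero h2.symm
  rw [← exp_log hz0, ← exp_nsmul, ← exp_nsmul, exp_inj, nsmul_eq_mul, nsmul_eq_mul] at h2
  have h3 : (N : ℤ) ∣ O.card := hNk.dvd_of_dvd_mul_right ⟨_, h2.symm⟩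
  have h4 : N ≤ O.card := Nat.le_of_dvd hO0 (by exact_mod_cast h3)
  have h5 : O = S := Finset.eq_of_subset_of_card_le hOS (hcard.trans h4)
  refine ⟨le_antisymm hcard (h5 ▸ h4), fun y' hy' => ?_⟩
  rw [← h5] at hy'
  exact (Finset.mem_filter.1 hy').2

end Inertia

/-! ### Translation between `ord` and the multiplicative valuation -/

section Ord

variable {K : Type*} [Field K] [NumberField K] (p : HeightOneSpectrum (𝓞 K))

theorem ord_eq_coe_iff {x : K} {k : ℤ} :
    ord p x = (k : WithTop ℤ) ↔ p.valuation K x = exp (-k) := by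
  unfold ord
  split_ifs with h
  · simp [h, exp_ne_zero.symm]
  · have h0 : p.valuation K x ≠ 0 := (Valuation.ne_zero_iff _).2 h
    rw [WithTop.coe_inj, neg_eq_iff_eq_neg]
    constructor
    · intro h'; rw [← h', exp_log h0]
    · intro h'; rw [h', log_exp]

theorem ord_lt_ord_iff {x y : K} : ord p x < ord p y ↔ p.valuation K y < p.valuation K x := by
  unfold ord
  split_ifs with hx hy hy
  · simp [hx, hy]
  · simp [hx]
  · rw [hy, map_zero]
    exact iff_of_true (WithTop.coe_lt_top _) (zero_lt_iff.2 ((Valuation.ne_zero_iff _).2 hx))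
  · have hx0 : p.valuation K x ≠ 0 := (Valuation.ne_zero_iff _).2 hx
    have hy0 : p.valuation K y ≠ 0 := (Valuation.ne_zero_iff _).2 hy
    rw [WithTop.coe_lt_coe, neg_lt_neg_iff, log_lt_log hy0 hx0]

theorem ord_one : ord p (1 : K) = 0 := by
  have := ord_eq_coe_iff p (x := 1) (k := 0)
  simpa using this

theorem ord_neg_iff {x : K} : ord p x < 0 ↔ 1 < p.valuation K x := by
  rw [← ord_one p, ord_lt_ord_iff, map_one]

theorem ord_eq_zero_iff {x : K} : ord p x = 0 ↔ p.valuation K x = 1 := by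
  have := ord_eq_coe_iff p (x := x) (k := 0)
  simpa using this

theorem one_le_ord_iff {x : K} : 1 ≤ ord p x ↔ p.valuation K x ≤ exp (-1) := by
  obtain ⟨y, hy⟩ := p.valuation_exists_uniformizer K
  have := (ord_eq_coe_iff p (x := y) (k := 1)).2 hy
  rw [← hy, ← not_lt, ← not_lt, ← ord_lt_ord_iff, this]
  rfl

end Ord

/-- The trinomial map `y ↦ y ^ d - b * y ^ m`. -/
def tri {R : Type*} [CommRing R] (d m : ℕ) (b y : R) : R := y ^ d - b * y ^ m

theorem map_tri {R S F : Type*} [CommRing R] [CommRing S] [FunLike F R S] [RingHomClass F R S]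
    (r : F) (d m : ℕ) (b y : R) : r (tri d m b y) = tri d m (r b) (r y) := by
  simp [tri]

theorem map_tri_iterate {R S F : Type*} [CommRing R] [CommRing S] [FunLike F R S]
    [RingHomClass F R S] (r : F) (d m : ℕ) (b y : R) (n : ℕ) :
    r ((tri d m b)^[n] y) = (tri d m (r b))^[n] (r y) :=
  Function.Semiconj.iterate_right (fun y => map_tri r d m b y) n y

/-! ### Trinomials over a residue field: critical points and collisions -/

section Reduction

variable {A k : Type*} [CommRing A] [Field k]

theorem eval_derivative_prod_eq_zero {T : Finset A} (r : A →+* k) {s t : A} (hs : s ∈ T)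
    (ht : t ∈ T) (hst : s ≠ t) (hr : r s = r t) :
    (derivative ((∏ t ∈ T, (X - C t)).map r)).eval (r s) = 0 := by
  classical
  rw [← Finset.mul_prod_erase T _ hs,
    ← Finset.mul_prod_erase (T.erase s) _ (Finset.mem_erase.2 ⟨hst.symm, ht⟩)]
  simp [hr]

theorem eval_derivative_derivative_prod_eq_zero {T : Finset A} (r : A →+* k) {s t u : A}
    (hs : s ∈ T) (ht : t ∈ T) (hu : u ∈ T) (hst : s ≠ t) (hsu : s ≠ u) (htu : t ≠ u)
    (hr : r s = r t) (hr' : r s = r u) :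
    (derivative (derivative ((∏ t ∈ T, (X - C t)).map r))).eval (r s) = 0 := by
  classical
  rw [← Finset.mul_prod_erase T _ hs,
    ← Finset.mul_prod_erase (T.erase s) _ (Finset.mem_erase.2 ⟨hst.symm, ht⟩),
    ← Finset.mul_prod_erase ((T.erase s).erase t) _
      (Finset.mem_erase.2 ⟨htu.symm, Finset.mem_erase.2 ⟨hsu.symm, hu⟩⟩)]
  simp [← hr, ← hr']

variable [IsDomain A]

theorem eq_prod_X_sub_C_of_card_eq {P : A[X]} (hP : P.Monic) {T : Finset A}
    (hT : ∀ t ∈ T, P.eval t = 0) (hc : T.card = P.natDegree) : P = ∏ t ∈ T, (X - C t) := by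
  have hle : T.val ≤ P.roots := by
    rw [Multiset.le_iff_subset T.nodup]
    exact fun t ht => (mem_roots hP.ne_zero).2 (hT t ht)
  have heq : T.val = P.roots :=
    Multiset.eq_of_le_of_card_le hle ((P.card_roots').trans hc.ge)
  have := prod_multiset_X_sub_C_of_monic_of_roots_card_eq hP (by rw [← heq]; exact hc)
  rw [← this, ← heq]
  rfl

theorem trinomial_monic {R : Type*} [CommRing R] [Nontrivial R] {d m : ℕ} (hmd : m < d)
    (hm : 0 < m) (b a : R) :
    (X ^ d - C b * X ^ m - C a).Monic ∧ (X ^ d - C b * X ^ m - C a).natDegree = d := by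
  have h : (C b * X ^ m + C a : R[X]).degree < d := by
    refine (degree_add_le _ _).trans_lt (max_lt ?_ ?_)
    · exact (degree_C_mul_X_pow_le _ _).trans_lt (by exact_mod_cast hmd)
    · exact degree_C_le.trans_lt (by exact_mod_cast hm.trans hmd)
  rw [sub_sub]
  have h' : (C b * X ^ m + C a : R[X]).degree < (X ^ d : R[X]).degree := by rwa [degree_X_pow]
  refine ⟨monic_X_pow_sub (n := d) ?_, ?_⟩
  · exact h
  · rw [natDegree_eq_of_degree_eq (degree_sub_eq_left_of_degree_lt h'), natDegree_X_pow]

theorem trinomial_eq_prod {d m : ℕ} (hmd : m < d) (hm : 0 < m) {b a : A} {T : Finset A}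
    (hT : ∀ t ∈ T, tri d m b t = a) (hc : T.card = d) :
    X ^ d - C b * X ^ m - C a = ∏ t ∈ T, (X - C t) := by
  obtain ⟨h1, h2⟩ := trinomial_monic hmd hm b a
  refine eq_prod_X_sub_C_of_card_eq h1 (fun t ht => ?_) (hc.trans h2.symm)
  have := hT t ht
  simp [← this, tri]

theorem eval_derivative_trinomial {d m : ℕ} (hmd : m < d) (hm : 0 < m) (b a z : k) :
    (derivative (X ^ d - C b * X ^ m - C a)).eval z
      = z ^ (m - 1) * (d * z ^ (d - m) - m * b) := by
  obtain ⟨m, rfl⟩ : ∃ j, m = j + 1 := ⟨m - 1, by omega⟩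
  obtain ⟨j, rfl⟩ : ∃ j, d = m + 1 + j := ⟨d - (m + 1), by omega⟩
  rw [show m + 1 + j - (m + 1) = j by omega]
  simp [derivative_X_pow, show m + 1 + j - 1 = m + j by omega]
  ring

/-- The first summand vanishes at nonzero critical points; the second shows that these are
nondegenerate when d(d − m) ≠ 0. -/
theorem eval_derivative_derivative_trinomial {d m : ℕ} (hmd : m < d) (hm : 2 ≤ m) (b a z : k) :
    z * (derivative (derivative (X ^ d - C b * X ^ m - C a))).eval z
      = z ^ (m - 1) * ((m - 1) * (d * z ^ (d - m) - m * b) + d * (d - m) * z ^ (d - m)) := by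
  obtain ⟨m, rfl⟩ : ∃ j, m = j + 2 := ⟨m - 2, by omega⟩
  obtain ⟨j, rfl⟩ : ∃ j, d = m + 2 + j := ⟨d - (m + 2), by omega⟩
  rw [show m + 2 + j - (m + 2) = j by omega]
  simp [derivative_X_pow, show m + 2 + j - 1 = m + j + 1 by omega]
  ring

/-- At most one nonzero critical point of the trinomial map has a given nonzero iterate. -/
theorem critical_point_unique {d m : ℕ} (hmd : m < d) (hcop : Nat.Coprime m d) {B c : k}
    (hd : (d : k) ≠ 0) (hc : c ≠ 0) {n : ℕ} {z z' : k} (hz0 : z ≠ 0)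
    (hz : d * z ^ (d - m) = m * B) (hz' : d * z' ^ (d - m) = m * B)
    (hn : (tri d m B)^[n] z = c) (hn' : (tri d m B)^[n] z' = c) : z = z' := by
  -- The ratio ζ is a (d−m)-th root of unity, and f(ηy) = η^m f(y) for such η. Equal nonzero
  -- iterates force ζ^(m^n) = 1, and m^n is prime to d − m.
  obtain ⟨ζ, rfl⟩ : ∃ ζ, z' = ζ * z := ⟨z' / z, (div_mul_cancel₀ _ hz0).symm⟩
  have hζ : ζ ^ (d - m) = 1 := by
    have h := hz'.trans hz.symm
    have h1 := mul_left_cancel₀ hd h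
    rw [mul_pow] at h1
    exact (mul_eq_right₀ (pow_ne_zero _ hz0)).1 h1
  have key : ∀ (j : ℕ) (η y : k), η ^ (d - m) = 1 →
      (tri d m B)^[j] (η * y) = η ^ m ^ j * (tri d m B)^[j] y := by
    intro j
    induction j with
    | zero => intro η y _; simp
    | succ j ih =>
      intro η y hη
      have h1 : tri d m B (η * y) = η ^ m * tri d m B y := by
        have h2 : η ^ d = η ^ m := by
          conv_lhs => rw [show d = m + (d - m) by omega, pow_add, hη, mul_one]
        simp only [tri, mul_pow, h2]; ring
      rw [Function.iterate_succ_apply, h1, ih _ _ (by rw [pow_right_comm, hη, one_pow]),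
        ← pow_mul, ← pow_succ', Function.iterate_succ_apply]
  have h1 := key n ζ z hζ
  rw [hn', hn] at h1
  have h2 : ζ ^ m ^ n = 1 := (mul_eq_right₀ hc).1 h1.symm
  have hco : Nat.Coprime (m ^ n) (d - m) :=
    Nat.Coprime.pow_left _ ((Nat.coprime_sub_self_right hmd.le).2 hcop)
  have h3 : ζ = 1 := by
    have := (orderOf_dvd_of_pow_eq_one h2)
    have h' := Nat.eq_one_of_dvd_coprimes hco this (orderOf_dvd_of_pow_eq_one hζ)
    exact orderOf_eq_one_iff.1 h'
  rw [h3, one_mul]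

/-- If reduction is injective on the `n`-th preimages, then at most one pair of `(n+1)`-st preimages
has the same reduction. -/
theorem collision_unique {d m : ℕ} (hm : 2 ≤ m) (hmd : m < d) (hcop : Nat.Coprime m d)
    (r : A →+* k) (hd : (d : k) ≠ 0) (hdm : (d : k) - m ≠ 0) {b c : A} (hc : r c ≠ 0) {n : ℕ}
    {T U : Finset A} (hT : ∀ t ∈ T, (tri d m b)^[n + 1] t = c)
    (hTU : ∀ t ∈ T, tri d m b t ∈ U)
    (hU : Set.InjOn r U) (hfib : ∀ γ ∈ U, ∃ S ⊆ T, S.card = d ∧ ∀ t, t ∈ S ↔ t ∈ T ∧ tri d m b t = γ)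
    {β₁ β₂ β₃ β₄ : A} (h1 : β₁ ∈ T) (h2 : β₂ ∈ T) (h3 : β₃ ∈ T) (h4 : β₄ ∈ T)
    (h12 : β₁ ≠ β₂) (h34 : β₃ ≠ β₄) (r12 : r β₁ = r β₂) (r34 : r β₃ = r β₄) :
    β₃ = β₁ ∨ β₃ = β₂ := by
  have hiter : ∀ β ∈ T, (tri d m (r b))^[n + 1] (r β) = r c := by
    intro β hβ
    rw [← map_tri_iterate, hT β hβ]
  -- Zero is a fixed point of the reduced map, whereas the orbit of r β ends at r c ≠ 0.
  have hne : ∀ β ∈ T, r β ≠ 0 := by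
    intro β hβ h0
    have h := hiter β hβ
    have hfix : tri d m (r b) 0 = 0 := by
      simp [tri, show d ≠ 0 by omega, show m ≠ 0 by omega]
    rw [h0, Function.iterate_fixed hfix] at h
    exact hc h.symm
  have hfeq : ∀ β ∈ T, ∀ β' ∈ T, r β = r β' → tri d m b β = tri d m b β' := by
    intro β hβ β' hβ' h
    refine hU (hTU _ hβ) (hTU _ hβ') ?_
    rw [map_tri, map_tri, h]
  have hpoly : ∀ (γ : A), (X ^ d - C b * X ^ m - C γ : A[X]).map r
      = X ^ d - C (r b) * X ^ m - C (r γ) := by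
    intro γ; simp
  -- Colliding points lie in one fiber, so their common reduction is a multiple root of the reduced
  -- trinomial.
  have hcrit : ∀ β ∈ T, ∀ β' ∈ T, β ≠ β' → r β = r β' → d * (r β) ^ (d - m) = m * r b := by
    intro β hβ β' hβ' hne' h
    obtain ⟨S, hS, hSc, hmem⟩ := hfib _ (hTU β hβ)
    have e := trinomial_eq_prod hmd (by omega) (fun t ht => ((hmem t).1 ht).2) hSc
    have := eval_derivative_prod_eq_zero r ((hmem β).2 ⟨hβ, rfl⟩)
      ((hmem β').2 ⟨hβ', (hfeq _ hβ _ hβ' h).symm⟩) hne' h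
    rw [← e, hpoly, eval_derivative_trinomial hmd (by omega)] at this
    exact sub_eq_zero.1 ((mul_eq_zero.1 this).resolve_left (pow_ne_zero _ (hne β hβ)))
  have hz : r β₁ = r β₃ := critical_point_unique hmd hcop hd hc (hne _ h1)
    (hcrit _ h1 _ h2 h12 r12) (hcrit _ h3 _ h4 h34 r34) (hiter _ h1) (hiter _ h3)
  -- All collisions occur at the same residue. A third point there would make a triple root,
  -- contradicting nondegeneracy of the critical point.
  by_contra hcon
  push Not at hcon
  obtain ⟨S, hS, hSc, hmem⟩ := hfib _ (hTU _ h1)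
  have e := trinomial_eq_prod hmd (by omega) (fun t ht => ((hmem t).1 ht).2) hSc
  have h5 := eval_derivative_derivative_prod_eq_zero r ((hmem β₁).2 ⟨h1, rfl⟩)
    ((hmem β₂).2 ⟨h2, (hfeq _ h1 _ h2 r12).symm⟩) ((hmem β₃).2 ⟨h3, (hfeq _ h1 _ h3 hz).symm⟩)
    h12 hcon.1.symm hcon.2.symm r12 hz
  rw [← e, hpoly] at h5
  have h6 := eval_derivative_derivative_trinomial hmd hm (r b) (r (tri d m b β₁)) (r β₁)
  rw [h5, mul_zero, hcrit _ h1 _ h2 h12 r12, sub_self, mul_zero, zero_add] at h6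
  exact mul_ne_zero (pow_ne_zero _ (hne _ h1))
    (mul_ne_zero (mul_ne_zero hd hdm) (pow_ne_zero _ (hne _ h1))) h6.symm

/-- The reductions of the roots of a trinomial whose constant term reduces to zero. -/
theorem trinomial_reduction {d m : ℕ} (hm : 0 < m) (hmd : m < d)
    (r : A →+* k) (hdm : (d : k) - m ≠ 0) {b a : A} (hb : r b ≠ 0) (ha : r a = 0)
    {T : Finset A} (hT : ∀ t ∈ T, tri d m b t = a) (hTc : T.card = d) [DecidableEq k] :
    (∀ s ∈ T, ∀ t ∈ T, s ≠ t → r s = r t → r s = 0) ∧ (T.filter (fun t => r t = 0)).card = m := by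
  have e := trinomial_eq_prod hmd hm hT hTc
  have e' : (∏ t ∈ T, (X - C t)).map r = X ^ d - C (r b) * X ^ m - C (r a) := by
    rw [← e]; simp
  constructor
  · intro s hs t ht hst h
    have h1 := eval_derivative_prod_eq_zero r hs ht hst h
    rw [e', eval_derivative_trinomial hmd hm] at h1
    -- A nonzero double root z has z^(d−m) = r b and d z^(d−m) = m · r b, so (d − m) · r b = 0.
    by_contra h0
    have h2 := (mul_eq_zero.1 h1).resolve_left (pow_ne_zero _ h0)
    have h3 : tri d m (r b) (r s) = 0 := by rw [← map_tri, hT s hs, ha]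
    have h4 : r s ^ m * (r s ^ (d - m) - r b) = 0 := by
      rw [← h3, tri, mul_sub, ← pow_add, show m + (d - m) = d by omega]; ring
    have h5 := (mul_eq_zero.1 h4).resolve_left (pow_ne_zero _ h0)
    rw [sub_eq_zero.1 h5, ← sub_mul] at h2
    exact mul_ne_zero hdm hb h2
  · have h1 : (∏ t ∈ T, (X - C t)).map r = (T.val.map (fun t => X - C (r t))).prod := by
      rw [Polynomial.map_prod, Finset.prod]
      simp
    have h2 : ((∏ t ∈ T, (X - C t)).map r).roots = T.val.map r := by
      have := roots_multiset_prod_X_sub_C (T.val.map r)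
      rw [Multiset.map_map] at this
      rw [h1]
      exact this
    -- As r b ≠ 0, this factorisation gives the root 0 multiplicity exactly m.
    have h3 : (X ^ d - C (r b) * X ^ m - C (r a) : k[X]) = X ^ m * (X ^ (d - m) - C (r b)) := by
      rw [mul_sub, ← pow_add, show m + (d - m) = d by omega, ha]; simp
    have hne : (X ^ (d - m) - C (r b) : k[X]) ≠ 0 := X_pow_sub_C_ne_zero (by omega) _
    have h4 : Multiset.count 0 ((∏ t ∈ T, (X - C t)).map r).roots = m := by
      rw [e', h3, count_roots, rootMultiplicity_mul (mul_ne_zero (by simp) hne)]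
      rw [rootMultiplicity_eq_zero (p := X ^ (d - m) - C (r b))]
      · have := rootMultiplicity_X_sub_C_pow (0 : k) m
        simpa using this
      · simp [show d - m ≠ 0 by omega, hb]
    rw [h2, Multiset.count_map] at h4
    rw [← h4, Finset.card_def, Finset.filter_val]
    congr 1
    exact Multiset.filter_congr (fun _ _ => eq_comm)

end Reduction

/-! ### Discriminants as products of root differences -/

section Discriminant

theorem eval_derivative_prod_X_sub_C {L : Type*} [Field L] [DecidableEq L] {T : Finset L} {s : L}
    (hs : s ∈ T) :
    (derivative (∏ t ∈ T, (X - C t))).eval s = ∏ t ∈ T.erase s, (s - t) :=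
  eval_multiset_prod_X_sub_C_derivative hs

/-- Up to sign the discriminant is the resultant of P and P', the product of P'(s) over the roots s;
the valuation removes the sign. -/
theorem valuation_discr {K L Γ : Type*} [Field K] [Field L] [Algebra K L] [DecidableEq L]
    [LinearOrderedCommGroupWithZero Γ] (v : Valuation L Γ) {P : K[X]} (hP : P.Monic)
    (hdeg : 0 < P.natDegree) {T : Finset L} (hT : ∀ t ∈ T, aeval t P = 0)
    (hc : T.card = P.natDegree) :
    v (algebraMap K L P.discr) = ∏ s ∈ T, ∏ t ∈ T.erase s, v (s - t) := by
  have hmonic := hP.map (algebraMap K L)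
  have hnat : (P.map (algebraMap K L)).natDegree = P.natDegree := hP.natDegree_map _
  have hprod : P.map (algebraMap K L) = ∏ t ∈ T, (X - C t) := by
    refine eq_prod_X_sub_C_of_card_eq hmonic (fun t ht => ?_) (hc.trans hnat.symm)
    rw [eval_map_algebraMap]
    exact hT t ht
  have hroots : (P.map (algebraMap K L)).roots = T.val := by
    rw [hprod, roots_prod_X_sub_C]
  have hsplit : (P.map (algebraMap K L)).Splits := by
    rw [hprod]
    exact Splits.prod fun t _ => Splits.X_sub_C t
  have h1 := congrArg (algebraMap K L) (resultant_deriv (f := P) (natDegree_pos_iff_degree_pos.1 hdeg))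
  rw [← resultant_map_map, ← derivative_map] at h1
  have h2 := resultant_eq_prod_eval (P.map (algebraMap K L)) (derivative (P.map (algebraMap K L)))
    (P.natDegree - 1) ((natDegree_derivative_le _).trans (by rw [hnat])) hsplit
  rw [hnat] at h2
  rw [h2, hmonic.leadingCoeff, one_pow, one_mul, hroots, hP.leadingCoeff, mul_one, map_mul,
    map_pow, map_neg, map_one] at h1
  have h3 := congrArg v h1
  rw [map_mul, map_pow, Valuation.map_neg, map_one, one_pow, one_mul] at h3
  rw [← h3]
  change v (∏ s ∈ T, _) = _
  rw [map_prod]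
  refine Finset.prod_congr rfl fun s hs => ?_
  rw [hprod, eval_derivative_prod_X_sub_C hs, map_prod]

/-- The product of all differences is, up to sign, a square of an element which is fixed by every
automorphism fixing the given set pointwise. -/
theorem exists_sqrt_prod_sub {L Γ : Type*} [Field L] [DecidableEq L]
    [LinearOrderedCommGroupWithZero Γ] (v : Valuation L Γ) (T : Finset L) :
    ∃ δ : L, (∀ σ : L ≃+* L, (∀ t ∈ T, σ t = t) → σ δ = δ) ∧
      ∏ s ∈ T, ∏ t ∈ T.erase s, v (s - t) = v δ ^ 2 := by
  obtain ⟨N, x, hinj, hT⟩ : ∃ (N : ℕ) (x : Fin N → L), Function.Injective x ∧ Finset.univ.image x = T := by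
    refine ⟨T.card, fun i => (T.equivFin.symm i : L),
      Subtype.val_injective.comp T.equivFin.symm.injective, ?_⟩
    ext t
    simp only [Finset.mem_image, Finset.mem_univ, true_and]
    exact ⟨by rintro ⟨i, rfl⟩; exact (T.equivFin.symm i).2,
      fun ht => ⟨T.equivFin ⟨t, ht⟩, by simp⟩⟩
  -- δ is the Vandermonde product: one factor for each unordered pair, which the full product counts
  -- twice.
  refine ⟨∏ i, ∏ j ∈ Finset.Ioi i, (x j - x i), fun σ hσ => ?_, ?_⟩
  · have hσx : ∀ i, σ (x i) = x i := fun i => hσ _ (hT ▸ Finset.mem_image_of_mem _ (Finset.mem_univ i))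
    simp [map_prod, hσx]
  · have h1 := Finset.prod_prod_Ioi_mul_eq_prod_prod_off_diag (fun i j => v (x i - x j))
    have h2 : ∏ s ∈ T, ∏ t ∈ T.erase s, v (s - t) = ∏ i, ∏ j ∈ {i}ᶜ, v (x j - x i) := by
      rw [← hT, Finset.prod_image hinj.injOn]
      refine Finset.prod_congr rfl fun i _ => ?_
      rw [← Finset.image_erase hinj, Finset.prod_image hinj.injOn, Finset.compl_eq_univ_sdiff,
        Finset.sdiff_singleton_eq_erase]
      exact Finset.prod_congr rfl fun j _ => Valuation.map_sub_swap _ _ _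
    rw [h2, ← h1, sq, map_prod, ← Finset.prod_mul_distrib]
    refine Finset.prod_congr rfl fun i _ => ?_
    rw [map_prod, ← Finset.prod_mul_distrib]
    refine Finset.prod_congr rfl fun j _ => ?_
    rw [Valuation.map_sub_swap v (x i) (x j)]

end Discriminant

/-! ### Iterates and the finite sets of preimages -/

section Iterate

variable {K : Type*} [Field K]

theorem iter_succ (f : K[X]) (n : ℕ) : iter f (n + 1) = f.comp (iter f n) :=
  Function.iterate_succ_apply' _ _ _

theorem aeval_iter {L : Type*} [Field L] [Algebra K L] (f : K[X]) (n : ℕ) (y : L) :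
    aeval y (iter f n) = (fun z => aeval z f)^[n] y := by
  induction n with
  | zero => simp [iter]
  | succ n ih => rw [iter_succ, aeval_comp, ih, Function.iterate_succ_apply']

theorem iter_monic {f : K[X]} (hf : f.Monic) (hd : f.natDegree ≠ 0) (n : ℕ) :
    (iter f n).Monic ∧ (iter f n).natDegree = f.natDegree ^ n := by
  induction n with
  | zero => exact ⟨monic_X, by simp [iter]⟩
  | succ n ih =>
    rw [iter_succ]
    refine ⟨hf.comp ih.1 ?_, ?_⟩
    · rw [ih.2]; exact pow_ne_zero _ hd
    · rw [natDegree_comp, ih.2, pow_succ']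

theorem iter_sub_C_monic {f : K[X]} (hf : f.Monic) (hd : f.natDegree ≠ 0) (n : ℕ) (c : K) :
    (iter f n - C c).Monic ∧ (iter f n - C c).natDegree = f.natDegree ^ n := by
  obtain ⟨h1, h2⟩ := iter_monic hf hd n
  have hpos : 0 < (iter f n).natDegree := by rw [h2]; positivity
  refine ⟨h1.sub_of_left ?_, by rw [natDegree_sub_C, h2]⟩
  exact degree_C_le.trans_lt (natDegree_pos_iff_degree_pos.1 hpos)

theorem trinomial_monic' {d m : ℕ} (hmd : m < d) (hm : 0 < m) (b : K) :
    (X ^ d - C b * X ^ m).Monic ∧ (X ^ d - C b * X ^ m).natDegree = d := by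
  simpa using trinomial_monic hmd hm b 0

theorem aeval_trinomial_iter {L : Type*} [Field L] [Algebra K L] (d m : ℕ) (b : K) (n : ℕ) (y : L) :
    aeval y (iter (X ^ d - C b * X ^ m) n) = (tri d m (algebraMap K L b))^[n] y := by
  rw [aeval_iter]
  congr 1
  ext z
  simp [tri]

open Classical in
/-- The `n`-th preimages of `c` under the trinomial map, as a finite set. -/
noncomputable def level (d m : ℕ) (b c : K) (n : ℕ) : Finset K :=
  (iter (X ^ d - C b * X ^ m) n - C c).roots.toFinset

variable {d m : ℕ} {b c : K}

theorem mem_level (hm : 0 < m) (hmd : m < d) {n : ℕ} {y : K} : y ∈ level d m b c n ↔ (tri d m b)^[n] y = c := by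
  obtain ⟨h1, h2⟩ := trinomial_monic' hmd hm b
  have h3 := (iter_sub_C_monic h1 (by omega) n c).1
  have h4 := aeval_trinomial_iter d m b n y
  rw [coe_aeval_eq_eval] at h4
  simp only [level, Multiset.mem_toFinset, mem_roots h3.ne_zero, IsRoot.def, eval_sub, eval_C]
  rw [h4, sub_eq_zero]
  rfl

theorem card_level_le (hm : 0 < m) (hmd : m < d) (n : ℕ) : (level d m b c n).card ≤ d ^ n := by
  obtain ⟨h1, h2⟩ := trinomial_monic' hmd hm b
  have h3 := (iter_sub_C_monic h1 (by omega) n c).2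
  rw [h2] at h3
  classical
  rw [← h3, level]
  exact (Multiset.toFinset_card_le _).trans (card_roots' _)

theorem mem_level_succ (hm : 0 < m) (hmd : m < d) {n : ℕ} {y : K} :
    y ∈ level d m b c (n + 1) ↔ tri d m b y ∈ level d m b c n := by
  rw [mem_level hm hmd, mem_level hm hmd, Function.iterate_succ_apply]

/-- Each of the d^n fibers has at most d points and they total d^(n+1), so none is smaller. -/
theorem card_fiber_eq (hm : 0 < m) (hmd : m < d) [DecidableEq K] {n : ℕ} (h0 : (level d m b c n).card = d ^ n)
    (h1 : (level d m b c (n + 1)).card = d ^ (n + 1)) {α : K} (hα : α ∈ level d m b c n) :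
    (level d m b α 1).card = d := by
  have hfib : ∀ α ∈ level d m b c n,
      ((level d m b c (n + 1)).filter (fun y => tri d m b y = α)) = level d m b α 1 := by
    intro α hα
    ext y
    rw [Finset.mem_filter, mem_level_succ hm hmd, mem_level (n := 1) hm hmd]
    exact ⟨fun h => h.2, fun h => ⟨by rw [show tri d m b y = α from h]; exact hα, h⟩⟩
  have hsum := Finset.card_eq_sum_card_fiberwise (f := tri d m b) (s := level d m b c (n + 1))
    (t := level d m b c n) (fun y hy => (mem_level_succ hm hmd).1 hy)
  rw [Finset.sum_congr rfl (fun α hα => by rw [hfib α hα]), h1] at hsum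
  have hle : ∀ α ∈ level d m b c n, (level d m b α 1).card ≤ d := fun α _ => by
    simpa using card_level_le (c := α) hm hmd 1
  have hconst : ∑ α ∈ level d m b c n, d = d ^ (n + 1) := by
    rw [Finset.sum_const, h0, smul_eq_mul, pow_succ]
  exact (Finset.sum_eq_sum_iff_of_le hle).1 (hsum.symm.trans hconst.symm) α hα

end Iterate

/-! ### Newton polygons of trinomials -/

section Valuation

variable {L Γ : Type*} [Field L] [LinearOrderedCommGroupWithZero Γ] (v : Valuation L Γ) {d m : ℕ}

theorem valuation_le_one_of_tri (hmd : m < d) {b a y : L} (hb : v b ≤ 1) (ha : v a ≤ 1)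
    (hy : tri d m b y = a) : v y ≤ 1 := by
  by_contra! h
  have h1 : v (b * y ^ m) < v (y ^ d) := by
    rw [map_mul, map_pow, map_pow]
    exact (mul_le_of_le_one_left zero_le hb).trans_lt (pow_lt_pow_right₀ h hmd)
  have h2 : v a = v (y ^ d) := by
    rw [← hy, tri, Valuation.map_sub_eq_of_lt_left _ h1]
  rw [h2, map_pow] at ha
  exact absurd (one_lt_pow₀ h (by omega : d ≠ 0)) (not_lt.2 ha)

theorem valuation_le_one_of_tri_iterate (hmd : m < d) {b a : L} (hb : v b ≤ 1) (ha : v a ≤ 1)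
    {n : ℕ} {y : L} (hy : (tri d m b)^[n] y = a) : v y ≤ 1 := by
  induction n generalizing y with
  | zero => simpa [← hy] using ha
  | succ n ih => exact valuation_le_one_of_tri v hmd hb (ih hy) rfl

/-- Newton polygon of the trinomial in the Eisenstein case. -/
theorem valuation_pow_of_eisenstein (hm : 0 < m) (hmd : m < d) {b a y : L} (hb : v b ≤ v a) (ha1 : v a < 1)
    (ha0 : v a ≠ 0) {n : ℕ} (hy : (tri d m b)^[n] y = a) :
    v y ^ d ^ n = v a ∧ v a ≤ v y ∧ v y < 1 := by
  induction n generalizing y with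
  | zero =>
    rw [← show y = a from hy]
    simpa [show y = a from hy] using ha1
  | succ n ih =>
    obtain ⟨h1, h2, h3⟩ := ih (y := tri d m b y) hy
    have hy1 : v y ≤ 1 := valuation_le_one_of_tri v hmd (hb.trans ha1.le) h3.le rfl
    -- If v y < 1, then v(b y^m) < v a ≤ v(f y), so y^d carries the value of f y; the inductive
    -- bound v a ≤ v(f y) serves here. If v y = 1, then y^d dominates b y^m directly; `hy2` excludes
    -- this case afterwards.
    have hd : v y ^ d = v (tri d m b y) := by
      rcases hy1.lt_or_eq with hlt | heq
      · have h4 : v (b * y ^ m) < v (tri d m b y) := by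
          refine lt_of_lt_of_le ?_ h2
          rw [map_mul, map_pow]
          calc v b * v y ^ m ≤ v a * v y ^ m := by gcongr
            _ < v a := mul_lt_of_lt_one_right (zero_lt_iff.2 ha0)
              (pow_lt_one₀ zero_le hlt hm.ne')
        have h5 : y ^ d = tri d m b y + b * y ^ m := by simp [tri]
        rw [← map_pow, h5, Valuation.map_add_eq_of_lt_left _ h4]
      · have h4 : v (b * y ^ m) < v (y ^ d) := by
          rw [map_mul, map_pow, map_pow, heq, one_pow, one_pow, mul_one]
          exact hb.trans_lt ha1
        rw [← map_pow, tri, Valuation.map_sub_eq_of_lt_left _ h4]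
    have hy2 : v y < 1 := by
      by_contra! h
      have : v y = 1 := le_antisymm hy1 h
      rw [← hd, this, one_pow] at h3
      exact lt_irrefl _ h3
    refine ⟨?_, ?_, hy2⟩
    · rw [pow_succ', pow_mul, hd, h1]
    · exact (h2.trans hd.ge).trans (pow_le_of_le_one zero_le hy1 (by omega))

theorem residue_eq_iff (x y : v.valuationSubring) :
    IsLocalRing.residue v.valuationSubring x = IsLocalRing.residue v.valuationSubring y ↔
      v ((x : L) - y) < 1 := by
  rw [← sub_eq_zero, ← map_sub, IsLocalRing.residue_eq_zero_iff, Valuation.mem_maximalIdeal_iff]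
  rfl

theorem residue_eq_zero_iff' (x : v.valuationSubring) :
    IsLocalRing.residue v.valuationSubring x = 0 ↔ v (x : L) < 1 := by
  rw [IsLocalRing.residue_eq_zero_iff, Valuation.mem_maximalIdeal_iff]

/-- The scaled roots of a trinomial with dominating middle coefficient: exactly `m` of them are
topologically nilpotent, and all other residue classes are distinct. -/
theorem scaled_roots (hm : 0 < m) (hmd : m < d) (hdm : v ((d : L) - m) = 1) {b c α : L}
    (hc : v c ^ (d - m) * v b = 1) (hb : 1 < v b) (hα : v α < v b) {T : Finset L}
    (hT : ∀ t ∈ T, tri d m b t = α) (hTc : T.card = d) :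
    (∀ t ∈ T, v (c * t) ≤ 1) ∧
      (∀ s ∈ T, ∀ t ∈ T, s ≠ t → v (c * s - c * t) < 1 → v (c * s) < 1) ∧
      (T.filter (fun t => v (c * t) < 1)).card = m := by
  classical
  have hc0 : c ≠ 0 := by
    rintro rfl
    rw [map_zero, zero_pow (by omega), zero_mul] at hc
    exact zero_ne_one hc
  have hc1 : v c ≤ 1 := by
    by_contra! h
    exact absurd hc (one_lt_mul_of_lt_of_le' (one_lt_pow₀ h (by omega)) hb.le).ne'
  have hvb : v (b * c ^ (d - m)) = 1 := by rw [map_mul, map_pow, mul_comm, hc]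
  have hva : v (α * c ^ d) < 1 := by
    have h1 : v (α * c ^ d) = v α * v c ^ (d - m) * v c ^ m := by
      rw [map_mul, map_pow, mul_assoc, ← pow_add, show d - m + m = d by omega]
    rw [h1]
    have h2 : v α * v c ^ (d - m) < 1 := by
      rw [← hc, mul_comm]
      exact mul_lt_mul_of_pos_left hα (pow_pos (zero_lt_iff.2 ((Valuation.ne_zero_iff _).2 hc0)) _)
    exact (mul_le_of_le_one_right zero_le (pow_le_one₀ zero_le hc1)).trans_lt h2
  -- Scaling by c makes the middle coefficient a unit and the constant term reduce to zero, as
  -- `trinomial_reduction` requires.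
  have hscale : ∀ t ∈ T, tri d m (b * c ^ (d - m)) (c * t) = α * c ^ d := by
    intro t ht
    rw [← hT t ht, tri, tri]
    have : c ^ d = c ^ (d - m) * c ^ m := by rw [← pow_add, show d - m + m = d by omega]
    rw [mul_pow, mul_pow, this]; ring
  have hint : ∀ t ∈ T, v (c * t) ≤ 1 := fun t ht =>
    valuation_le_one_of_tri v hmd hvb.le hva.le (hscale t ht)
  let A := v.valuationSubring
  let g : T ↪ A := ⟨fun t => ⟨c * t, hint t t.2⟩, fun s t h => by
    have := congrArg (Subtype.val : A → L) h
    exact Subtype.ext (mul_left_cancel₀ hc0 this)⟩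
  have key := trinomial_reduction hm hmd (IsLocalRing.residue A)
    (b := (⟨b * c ^ (d - m), hvb.le⟩ : A)) (a := (⟨α * c ^ d, hva.le⟩ : A)) (T := T.attach.map g)
    (by
      have h := (residue_eq_zero_iff' v ((d : A) - m)).not
      rw [map_sub, map_natCast, map_natCast] at h
      rw [← ne_eq] at h
      rw [h]
      push_cast
      rw [hdm]
      exact lt_irrefl _)
    (by
      rw [ne_eq, residue_eq_zero_iff', hvb]
      exact lt_irrefl _)
    ((residue_eq_zero_iff' v _).2 hva)
    (by
      intro t ht
      obtain ⟨s, -, rfl⟩ := Finset.mem_map.1 ht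
      exact Subtype.ext (hscale s s.2))
    (by simp [hTc])
  refine ⟨hint, fun s hs t ht hst h => ?_, ?_⟩
  · have := key.1 (g ⟨s, hs⟩) (Finset.mem_map_of_mem _ (Finset.mem_attach _ _))
      (g ⟨t, ht⟩) (Finset.mem_map_of_mem _ (Finset.mem_attach _ _))
      (fun h' => hst (congrArg Subtype.val (g.injective h'))) ((residue_eq_iff v _ _).2 h)
    exact (residue_eq_zero_iff' v _).1 this
  · rw [← key.2, Finset.filter_map, Finset.card_map, ← Finset.card_map (Function.Embedding.subtype _)]
    congr 1
    ext t
    simp only [Finset.mem_filter, Finset.mem_map, Finset.mem_attach, true_and, Function.comp]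
    constructor
    · rintro ⟨ht, h⟩
      exact ⟨⟨t, ht⟩, (residue_eq_zero_iff' v _).2 h, rfl⟩
    · rintro ⟨s, h, rfl⟩
      exact ⟨s.2, (residue_eq_zero_iff' v _).1 h⟩

theorem valuation_pow_lt_of_small (hmd : m < d) {b c y : L}
    (hc : v c ^ (d - m) * v b = 1) (hy : v (c * y) < 1) : v (y ^ (d - m)) < v b := by
  have h2 : v c ^ (d - m) * v y ^ (d - m) < v c ^ (d - m) * v b := by
    rw [hc, ← mul_pow, ← map_mul]
    exact pow_lt_one₀ zero_le hy (by omega)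
  rw [map_pow]
  exact lt_of_mul_lt_mul_left h2 zero_le

/-- In f y = y^m (y^(d−m) − b) the term b dominates y^(d−m) when c·y is small. -/
theorem valuation_pow_of_small (hmd : m < d) {b c y : L}
    (hc : v c ^ (d - m) * v b = 1) (hy : v (c * y) < 1) :
    v y ^ m * v b = v (tri d m b y) := by
  have h1 := valuation_pow_lt_of_small v hmd hc hy
  have h2 : tri d m b y = y ^ m * (y ^ (d - m) - b) := by
    rw [tri, mul_sub, ← pow_add, show m + (d - m) = d by omega]; ring
  rw [h2, map_mul, Valuation.map_sub_eq_of_lt_right _ h1, map_pow]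

theorem valuation_lt_of_small (hmd : m < d) {b c y : L}
    (hc : v c ^ (d - m) * v b = 1) (hb : 1 < v b) (hy : v (c * y) < 1) : v y < v b := by
  have h1 := valuation_pow_lt_of_small v hmd hc hy
  rcases le_total (v y) 1 with h | h
  · exact h.trans_lt hb
  · refine lt_of_le_of_lt ?_ h1
    rw [map_pow]
    exact le_self_pow₀ h (by omega)

end Valuation

/-! ### Galois elements obtained from inertia at the three kinds of primes -/

section Galois

variable {K L : Type*} [Field K] [Field L] [Algebra K L]
  {d m : ℕ} {b x₀ : K}

theorem apply_tri (σ : Gal(L/K)) (y : L) :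
    σ (tri d m (algebraMap K L b) y) = tri d m (algebraMap K L b) (σ y) := by
  rw [map_tri, AlgEquiv.commutes]

theorem apply_mem_level (hm : 0 < m) (hmd : m < d) (σ : Gal(L/K)) {n : ℕ} {y : L}
    (hy : y ∈ level d m (algebraMap K L b) (algebraMap K L x₀) n) :
    σ y ∈ level d m (algebraMap K L b) (algebraMap K L x₀) n := by
  rw [mem_level hm hmd] at hy ⊢
  have := map_tri_iterate σ d m (algebraMap K L b) y n
  rw [AlgEquiv.commutes, hy, AlgEquiv.commutes] at this
  exact this.symm

variable [NumberField K] [NumberField L] [IsGalois K L]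

/-- Every level-n point has value v(x₀)^(1/d^n) and x₀ has order 1, so `inertia_transitive` applies
with N = d^n. -/
theorem level_transitive (hm : 0 < m) (hmd : m < d) (p : HeightOneSpectrum (𝓞 K))
    (hb : p.valuation K b ≤ exp (-1)) (hx₀ : p.valuation K x₀ = exp (-1)) {n : ℕ} {y₀ : L}
    (hy₀ : y₀ ∈ level d m (algebraMap K L b) (algebraMap K L x₀) n) :
    (level d m (algebraMap K L b) (algebraMap K L x₀) n).card = d ^ n ∧
      ∀ y ∈ level d m (algebraMap K L b) (algebraMap K L x₀) n,
      ∀ y' ∈ level d m (algebraMap K L b) (algebraMap K L x₀) n, ∃ σ : Gal(L/K), σ y = y' := by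
  obtain ⟨v, e, I, he, hvK, hfix, -⟩ := exists_valuation_inertia L p
  have hv : ∀ y ∈ level d m (algebraMap K L b) (algebraMap K L x₀) n,
      v y ^ d ^ n = v (algebraMap K L x₀) := by
    intro y hy
    refine (valuation_pow_of_eisenstein v hm hmd ?_ ?_ ?_ ((mem_level hm hmd).1 hy)).1
    · rw [hvK, hvK, hx₀]
      exact pow_le_pow_left₀ zero_le hb e
    · rw [hvK, hx₀]
      refine pow_lt_one₀ zero_le ?_ he
      rw [← exp_zero, exp_lt_exp]
      norm_num
    · rw [hvK, hx₀]
      exact pow_ne_zero _ exp_ne_zero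
  have key := fun y hy => inertia_transitive he hvK hfix
    (level d m (algebraMap K L b) (algebraMap K L x₀) n)
    (fun σ _ y hy => apply_mem_level hm hmd σ hy) (card_level_le hm hmd n) hv hx₀
    (isCoprime_one_right.neg_right) (y := y) hy
  refine ⟨(key y₀ hy₀).1, fun y hy y' hy' => ?_⟩
  obtain ⟨σ, -, h⟩ := (key y hy).2 y' hy'
  exact ⟨σ, h⟩

theorem exists_transitive_on_part (hm : 2 ≤ m) (hmd : m < d) (p : HeightOneSpectrum (𝓞 K))
    (hdm : p.valuation K ((d : K) - m) = 1)
    {j k : ℤ} (hb : p.valuation K b = exp (-((d - m : ℤ) * j))) (hb1 : 1 < p.valuation K b)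
    (hx₀b : p.valuation K x₀ < p.valuation K b)
    (hk : p.valuation K (x₀ / b) = exp (-k)) (hmk : IsCoprime (m : ℤ) k) {n : ℕ}
    (hcard : ∀ i ≤ n + 1, (level d m (algebraMap K L b) (algebraMap K L x₀) i).card = d ^ i) :
    ∃ α ∈ level d m (algebraMap K L b) (algebraMap K L x₀) n,
      ∃ S ⊆ level d m (algebraMap K L b) α 1, S.card = m ∧
        ∀ s ∈ S, ∀ s' ∈ S, ∃ σ : Gal(L/K), σ s = s' ∧
          ∀ t ∈ level d m (algebraMap K L b) α 1, t ∉ S → σ t = t := by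
  classical
  have hm0 : 0 < m := by omega
  obtain ⟨v, e, I, he, hvK, hfix, hI⟩ := exists_valuation_inertia L p
  obtain ⟨π, hπ⟩ := p.valuation_exists_uniformizer K
  have hb0 : p.valuation K b ≠ 0 := (zero_lt_one.trans hb1).ne'
  set B := algebraMap K L b with hB
  -- Since b has order (d − m)j, this choice makes c^(d−m) b a unit.
  set c := algebraMap K L (π ^ (-j)) with hc
  have hcK : p.valuation K (π ^ (-j)) = exp j := by
    rw [map_zpow₀, hπ, ← exp_zsmul]; simp
  have hcb : v c ^ (d - m) * v B = 1 := by
    have h0 : p.valuation K (π ^ (-j)) ^ (d - m) * p.valuation K b = 1 := by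
      rw [hcK, hb, ← exp_nsmul, ← exp_add, ← exp_zero, exp_inj, nsmul_eq_mul,
        Nat.cast_sub hmd.le]
      ring
    rw [hc, hB, hvK, hvK, pow_right_comm, ← mul_pow, h0, one_pow]
  have hvB : 1 < v B := by rw [hB, hvK]; exact one_lt_pow₀ hb1 he
  have hvx : v (algebraMap K L x₀) < v B := by
    rw [hB, hvK, hvK]; exact pow_lt_pow_left₀ hx₀b zero_le he
  have hvdm : v ((d : L) - m) = 1 := by
    have := hvK ((d : K) - m)
    rw [hdm, one_pow] at this
    simpa using this
  -- Points reached from x₀ by taking a small root at each step; x₀ itself is unconstrained, hence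
  -- `j < i`.
  let S : ℕ → Finset L := fun i => (level d m B (algebraMap K L x₀) i).filter
    (fun y => ∀ j < i, v (c * (tri d m B)^[j] y) < 1)
  have hS0 : ∀ y, y ∈ S 0 ↔ y = algebraMap K L x₀ := by
    intro y
    simp [S, mem_level hm0 hmd]
  have hSsucc : ∀ i y, y ∈ S (i + 1) ↔ tri d m B y ∈ S i ∧ v (c * y) < 1 := by
    intro i y
    simp only [S, Finset.mem_filter, mem_level_succ hm0 hmd]
    constructor
    · rintro ⟨h1, h2⟩
      exact ⟨⟨h1, fun j hj => by simpa using h2 (j + 1) (by omega)⟩, by simpa using h2 0 (by omega)⟩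
    · rintro ⟨⟨h1, h2⟩, h3⟩
      refine ⟨h1, fun j hj => ?_⟩
      rcases j with _ | j
      · simpa using h3
      · simpa using h2 j (by omega)
  have hSlevel : ∀ i, S i ⊆ level d m B (algebraMap K L x₀) i := fun i => Finset.filter_subset _ _
  have hSlt : ∀ i, ∀ α ∈ S i, v α < v B := by
    intro i α hα
    rcases i with _ | i
    · rw [(hS0 α).1 hα]; exact hvx
    · exact valuation_lt_of_small v hmd hcb hvB ((hSsucc i α).1 hα).2
  have hfib : ∀ i ≤ n, ∀ α ∈ S i,
      (∀ t ∈ level d m B α 1, v (c * t) ≤ 1) ∧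
      (∀ s ∈ level d m B α 1, ∀ t ∈ level d m B α 1, s ≠ t → v (c * s - c * t) < 1 →
        v (c * s) < 1) ∧ ((level d m B α 1).filter (fun t => v (c * t) < 1)).card = m := by
    intro i hi α hα
    exact scaled_roots v hm0 hmd hvdm hcb hvB (hSlt i α hα)
      (fun t ht => (mem_level (n := 1) hm0 hmd).1 ht)
      (card_fiber_eq hm0 hmd (hcard i (by omega)) (hcard (i + 1) (by omega)) (hSlevel i hα))
  have hScard : ∀ i ≤ n + 1, (S i).card = m ^ i := by
    intro i
    induction i with
    | zero =>
      intro _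
      rw [pow_zero, Finset.card_eq_one]
      exact ⟨algebraMap K L x₀, by ext y; rw [hS0, Finset.mem_singleton]⟩
    | succ i ih =>
      intro hi
      rw [Finset.card_eq_sum_card_fiberwise (f := tri d m B) (t := S i)
        (fun y hy => ((hSsucc i y).1 hy).1), pow_succ, ← ih (by omega), ← smul_eq_mul,
        ← Finset.sum_const]
      refine Finset.sum_congr rfl fun α hα => ?_
      refine Eq.trans (congrArg Finset.card ?_) (hfib i (by omega) α hα).2.2
      ext y
      constructor
      · intro h
        obtain ⟨h1, h3⟩ := Finset.mem_filter.1 h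
        exact Finset.mem_filter.2 ⟨(mem_level (n := 1) hm0 hmd).2 h3, ((hSsucc i y).1 h1).2⟩
      · intro h
        obtain ⟨h1, h2⟩ := Finset.mem_filter.1 h
        have h3 : tri d m B y = α := (mem_level (n := 1) hm0 hmd).1 h1
        exact Finset.mem_filter.2 ⟨(hSsucc i y).2 ⟨h3.symm ▸ hα, h2⟩, h3⟩
  -- By v(y)^m v(b) = v(f y), passing from i to i + 1 divides z by b^(m^i). The first step gives
  -- x₀/b, of order prime to m; later steps change the order by multiples of m.
  have hval : ∀ i, ∃ z : K, ∃ l : ℤ, p.valuation K z = exp l ∧ (i ≠ 0 → IsCoprime (m : ℤ) l) ∧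
      (i = 0 → z = x₀) ∧ ∀ y ∈ S i, v y ^ m ^ i = v (algebraMap K L z) := by
    have hx₀e : p.valuation K x₀ = exp (-k - (d - m : ℤ) * j) := by
      rw [map_div₀, div_eq_iff hb0, hb, ← exp_add] at hk
      rw [hk]
      congr 1
    intro i
    induction i with
    | zero =>
      refine ⟨x₀, _, hx₀e, by simp, by simp, fun y hy => ?_⟩
      rw [(hS0 y).1 hy, pow_zero, pow_one]
    | succ i ih =>
      obtain ⟨z, l, hz, hl, hz0, hy⟩ := ih
      refine ⟨z / b ^ m ^ i, l + m ^ i * ((d - m : ℤ) * j), ?_, fun _ => ?_, by simp,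
        fun y hyS => ?_⟩
      · rw [map_div₀, map_pow, hz, hb, div_eq_iff (pow_ne_zero _ exp_ne_zero), ← exp_nsmul,
          ← exp_add, exp_inj, nsmul_eq_mul]
        push_cast
        ring
      · rcases i with _ | i
        · have hl' : l = -k - (d - m : ℤ) * j := by
            rw [hz0 rfl, hx₀e, exp_inj] at hz
            exact hz.symm
          rw [hl', pow_zero, one_mul, sub_add_cancel]
          exact hmk.neg_right
        · rw [pow_succ', mul_assoc]
          exact (hl (by omega)).add_mul_left_right _
      · obtain ⟨h1, h2⟩ := (hSsucc i y).1 hyS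
        have h3 := hy _ h1
        rw [← valuation_pow_of_small v hmd hcb h2, mul_pow, ← pow_mul, ← pow_succ'] at h3
        rw [map_div₀, map_div₀, map_pow, map_pow, ← h3, ← hB,
          mul_div_cancel_right₀ _ (pow_ne_zero _ (zero_lt_one.trans hvB).ne')]
  obtain ⟨z, l, hz, hl, -, hzy⟩ := hval (n + 1)
  have hstab : ∀ σ ∈ I, ∀ i, ∀ y ∈ S i, σ y ∈ S i := by
    intro σ hσ i
    induction i with
    | zero =>
      intro y hy
      rw [hS0] at hy ⊢
      rw [hy, AlgEquiv.commutes]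
    | succ i ih =>
      intro y hy
      rw [hSsucc] at hy ⊢
      refine ⟨by rw [← apply_tri]; exact ih _ hy.1, ?_⟩
      have h1 := hI σ hσ (c * y) hy.2.le
      have h2 : c * σ y = (σ (c * y) - c * y) + c * y := by
        rw [map_mul, hc, AlgEquiv.commutes]; ring
      rw [h2]
      exact (Valuation.map_add _ _ _).trans_lt (max_lt h1 hy.2)
  have hcop : IsCoprime ((m ^ (n + 1) : ℕ) : ℤ) l := by
    push_cast
    exact (hl (by omega)).pow_left
  obtain ⟨α, hα⟩ : (S n).Nonempty := by
    rw [← Finset.card_pos, hScard n (by omega)]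
    positivity
  obtain ⟨f1, f2, f3⟩ := hfib n le_rfl α hα
  have hmemS : ∀ s ∈ (level d m B α 1).filter (fun t => v (c * t) < 1),
      tri d m B s = α ∧ s ∈ S (n + 1) := by
    intro s hs
    obtain ⟨h1, h2⟩ := Finset.mem_filter.1 hs
    have h3 : tri d m B s = α := (mem_level (n := 1) hm0 hmd).1 h1
    exact ⟨h3, (hSsucc n s).2 ⟨h3 ▸ hα, h2⟩⟩
  refine ⟨α, hSlevel n hα, (level d m B α 1).filter (fun t => v (c * t) < 1),
    Finset.filter_subset _ _, f3, fun s hs s' hs' => ?_⟩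
  obtain ⟨hsα, hsS⟩ := hmemS s hs
  obtain ⟨hsα', hsS'⟩ := hmemS s' hs'
  obtain ⟨σ, hσ, hσs⟩ := (inertia_transitive he hvK hfix (S (n + 1))
    (fun σ hσ y hy => hstab σ hσ _ y hy) (hScard (n + 1) le_rfl).le hzy hz hcop hsS).2 s' hsS'
  refine ⟨σ, hσs, fun t ht htS => ?_⟩
  -- As s and s' both lie over α, σ fixes α and permutes its fiber. A root t that is not small is
  -- alone in the residue class of c·t, which inertia preserves, so σ t = t.
  have hσα : σ α = α := by rw [← hsα, hB, apply_tri, ← hB, hσs, hsα', hsα]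
  have hσt : σ t ∈ level d m B α 1 := by
    rw [mem_level (n := 1) hm0 hmd] at ht ⊢
    change tri d m B t = α at ht
    change tri d m B (σ t) = α
    rw [hB, ← apply_tri, ← hB, ht, hσα]
  by_contra hne
  have h1 := hI σ hσ (c * t) (f1 t ht)
  rw [map_mul, hc, AlgEquiv.commutes, ← hc, Valuation.map_sub_swap] at h1
  exact htS (Finset.mem_filter.2 ⟨ht, f2 t ht _ hσt (Ne.symm hne) h1⟩)

/-- If inertia fixed level n+1 pointwise, it would fix a square root of the discriminant up to sign,
whose order would then be even. An inertia element preserves residue classes, and `collision_unique`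
allows only one pair to share a class, so a nontrivial one is a transposition. -/
theorem exists_transposition (hm : 2 ≤ m) (hmd : m < d) (hcop : Nat.Coprime m d)
    (p : HeightOneSpectrum (𝓞 K)) (hb : p.valuation K b ≤ 1) (hx₀ : p.valuation K x₀ = 1)
    (hd : p.valuation K (d : K) = 1) (hdm : p.valuation K ((d : K) - m) = 1) {n : ℕ}
    (hdisc₀ : p.valuation K (iter (X ^ d - C b * X ^ m) n - C x₀).discr = 1) {k : ℤ}
    (hdisc : p.valuation K (iter (X ^ d - C b * X ^ m) (n + 1) - C x₀).discr = exp (-k))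
    (hk : Odd k)
    (hcard : ∀ i ≤ n + 1, (level d m (algebraMap K L b) (algebraMap K L x₀) i).card = d ^ i) :
    ∃ β₁ ∈ level d m (algebraMap K L b) (algebraMap K L x₀) (n + 1),
      ∃ β₂ ∈ level d m (algebraMap K L b) (algebraMap K L x₀) (n + 1), β₁ ≠ β₂ ∧
      ∃ σ : Gal(L/K), σ β₁ = β₂ ∧ σ β₂ = β₁ ∧
        ∀ t ∈ level d m (algebraMap K L b) (algebraMap K L x₀) (n + 1),
          t ≠ β₁ → t ≠ β₂ → σ t = t := by
  classical
  have hm0 : 0 < m := by omega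
  obtain ⟨v, e, I, he, hvK, hfix, hI⟩ := exists_valuation_inertia L p
  set B := algebraMap K L b with hB
  set c := algebraMap K L x₀ with hc
  have hvB : v B ≤ 1 := by rw [hB, hvK]; exact pow_le_one₀ zero_le hb
  have hvc : v c = 1 := by rw [hc, hvK, hx₀, one_pow]
  have hvd : v (d : L) = 1 := by
    have := hvK (d : K)
    rwa [hd, one_pow, map_natCast] at this
  have hvdm : v ((d : L) - m) = 1 := by
    have := hvK ((d : K) - m)
    rw [hdm, one_pow] at this
    simpa using this
  have hint : ∀ i, ∀ y ∈ level d m B c i, v y ≤ 1 := fun i y hy =>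
    valuation_le_one_of_tri_iterate v hmd hvB hvc.le ((mem_level hm0 hmd).1 hy)
  have hdiscr : ∀ i ≤ n + 1,
      p.valuation K (iter (X ^ d - C b * X ^ m) i - C x₀).discr ^ e =
        ∏ s ∈ level d m B c i, ∏ t ∈ (level d m B c i).erase s, v (s - t) := by
    intro i hi
    obtain ⟨h1, h2⟩ := trinomial_monic' hmd hm0 b
    obtain ⟨h3, h4⟩ := iter_sub_C_monic h1 (by omega) i x₀
    rw [h2] at h4
    rw [← hvK]
    refine valuation_discr v h3 (by rw [h4]; exact pow_pos (by omega) _) (fun t ht => ?_) ((hcard i hi).trans h4.symm)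
    rw [map_sub, aeval_trinomial_iter, aeval_C, (mem_level hm0 hmd).1 ht, sub_self]
  -- A product of factors ≤ 1 equals 1, so each difference of level-n points is a unit.
  have hdistinct : ∀ s ∈ level d m B c n, ∀ t ∈ level d m B c n, v (s - t) < 1 → s = t := by
    have h1 := hdiscr n (by omega)
    rw [hdisc₀, one_pow] at h1
    have hle : ∀ s ∈ level d m B c n, ∀ t ∈ level d m B c n, v (s - t) ≤ 1 := fun s hs t ht =>
      (Valuation.map_sub _ _ _).trans (max_le (hint _ _ hs) (hint _ _ ht))
    have hle' : ∀ s ∈ level d m B c n, ∏ t ∈ (level d m B c n).erase s, v (s - t) ≤ 1 :=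
      fun s hs => Finset.prod_le_one' fun t ht => hle s hs t (Finset.mem_of_mem_erase ht)
    have h2 := (Finset.prod_eq_one_iff_of_le_one' hle').1 h1.symm
    intro s hs t ht hst
    by_contra hne
    have h3 := (Finset.prod_eq_one_iff_of_le_one'
      (fun t ht => hle s hs t (Finset.mem_of_mem_erase ht))).1 (h2 s hs) t
      (Finset.mem_erase.2 ⟨Ne.symm hne, ht⟩)
    exact hst.ne h3
  obtain ⟨σ, hσ, β₁, hβ₁, hne⟩ : ∃ σ ∈ I, ∃ β ∈ level d m B c (n + 1), σ β ≠ β := by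
    by_contra! hall
    obtain ⟨δ, hδ, hδ2⟩ := exists_sqrt_prod_sub v (level d m B c (n + 1))
    obtain ⟨z, hz⟩ := hfix δ (fun σ hσ => hδ (σ : L ≃+* L) (hall σ hσ))
    have h1 := hdiscr (n + 1) le_rfl
    rw [hδ2, hdisc, hz, pow_right_comm] at h1
    have h2 : exp (-k) = z ^ 2 := (pow_left_inj₀ zero_le zero_le he).1 h1
    have hz0 : z ≠ 0 := by
      rintro rfl
      rw [zero_pow two_ne_zero] at h2
      exact exp_ne_zero h2
    rw [← exp_log hz0, ← exp_nsmul, exp_inj, nsmul_eq_mul] at h2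
    obtain ⟨j, hj⟩ := hk
    push_cast at h2
    omega
  have hσlevel : ∀ t ∈ level d m B c (n + 1), σ t ∈ level d m B c (n + 1) := fun t ht =>
    apply_mem_level hm0 hmd σ ht
  let A := v.valuationSubring
  let lift : Finset L → Finset A := fun F => Finset.subtype (· ∈ v.valuationSubring) F
  have hlift : ∀ (F : Finset L) (t : A), t ∈ lift F ↔ (t : L) ∈ F := fun F t => Finset.mem_subtype
  have hliftcard : ∀ F : Finset L, (∀ t ∈ F, v t ≤ 1) → (lift F).card = F.card := by
    intro F hF
    rw [Finset.card_subtype, Finset.filter_true_of_mem]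
    exact hF
  let B' : A := ⟨B, hvB⟩
  let c' : A := ⟨c, hvc.le⟩
  have hcoe : ∀ t : A, ((tri d m B' t : A) : L) = tri d m B t := fun t =>
    map_tri A.subtype d m B' t
  have hcoe' : ∀ (i : ℕ) (t : A), (((tri d m B')^[i] t : A) : L) = (tri d m B)^[i] t := fun i t =>
    map_tri_iterate A.subtype d m B' t i
  have hunit : ∀ x : A, v (x : L) = 1 → IsLocalRing.residue A x ≠ 0 := by
    intro x hx h
    rw [residue_eq_zero_iff', hx] at h
    exact lt_irrefl _ h
  have key : ∀ t ∈ level d m B c (n + 1), σ t ≠ t → t = β₁ ∨ t = σ β₁ := by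
    intro t ht htne
    have hmem : ∀ y (hy : y ∈ level d m B c (n + 1)),
        (⟨y, hint _ y hy⟩ : A) ∈ lift (level d m B c (n + 1)) := fun y hy => (hlift _ _).2 hy
    have := collision_unique hm hmd hcop (IsLocalRing.residue A) (b := B') (c := c') (n := n)
      (T := lift (level d m B c (n + 1))) (U := lift (level d m B c n))
      (by
        have := hunit (d : A) (by simpa using hvd)
        rwa [map_natCast] at this)
      (by
        have := hunit ((d : A) - m) (by simpa using hvdm)
        rwa [map_sub, map_natCast, map_natCast] at this)
      (hunit _ hvc)
      (fun t ht => Subtype.ext (by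
        rw [hcoe']
        exact (mem_level hm0 hmd).1 ((hlift _ _).1 ht)))
      (fun t ht => by
        rw [hlift, hcoe, ← mem_level_succ hm0 hmd]
        exact (hlift _ _).1 ht)
      (fun s hs t ht hst => Subtype.ext (hdistinct _ ((hlift _ _).1 hs) _ ((hlift _ _).1 ht)
        ((residue_eq_iff v _ _).1 hst)))
      (fun γ hγ => by
        have hγ' := (hlift _ _).1 hγ
        refine ⟨lift (level d m B γ 1), fun t ht => ?_, ?_, fun t => ?_⟩
        · rw [hlift] at ht ⊢
          rw [mem_level_succ hm0 hmd, show tri d m B t = γ from (mem_level (n := 1) hm0 hmd).1 ht]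
          exact hγ'
        · rw [hliftcard, card_fiber_eq hm0 hmd (hcard n (by omega)) (hcard _ le_rfl) hγ']
          exact fun t ht => valuation_le_one_of_tri v hmd hvB γ.2
            ((mem_level (n := 1) hm0 hmd).1 ht)
        · rw [hlift, hlift, mem_level (n := 1) hm0 hmd, Subtype.ext_iff, hcoe,
            mem_level_succ hm0 hmd]
          constructor
          · intro h
            exact ⟨by rw [show tri d m B t = γ from h]; exact hγ', h⟩
          · exact fun h => h.2)
      (hmem β₁ hβ₁) (hmem (σ β₁) (hσlevel _ hβ₁)) (hmem t ht) (hmem (σ t) (hσlevel _ ht))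
      (fun h => hne (congrArg Subtype.val h).symm) (fun h => htne (congrArg Subtype.val h).symm)
      ((residue_eq_iff v _ _).2 (by
        rw [Valuation.map_sub_swap]; exact hI σ hσ β₁ (hint _ _ hβ₁)))
      ((residue_eq_iff v _ _).2 (by
        rw [Valuation.map_sub_swap]; exact hI σ hσ t (hint _ _ ht)))
    exact this.imp (congrArg Subtype.val) (congrArg Subtype.val)
  -- The point σ(σβ₁) is also moved, so it is β₁ or σβ₁; the latter is excluded here.
  have hne2 : σ (σ β₁) ≠ σ β₁ := fun h => hne (σ.injective h)
  refine ⟨β₁, hβ₁, σ β₁, hσlevel _ hβ₁, hne.symm, σ, rfl, ?_, fun t ht h1 h2 => ?_⟩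
  · refine (key _ (hσlevel _ (hσlevel _ hβ₁)) fun h => hne2 (σ.injective h)).resolve_right hne2
  · by_contra h
    exact (key t ht h).elim h1 h2

end Galois

/-! ### Generating fiber-preserving permutations by transpositions -/

section Perm

open Equiv

/-- For distinct points, (x z) is the conjugate of (y z) by (x y). -/
theorem swap_mem_trans {X : Type*} [DecidableEq X] {H : Subgroup (Perm X)} {x y z : X} (hxy : swap x y ∈ H)
    (hyz : swap y z ∈ H) : swap x z ∈ H := by
  rcases eq_or_ne z x with rfl | hzx
  · rw [swap_self]; exact H.one_mem
  rcases eq_or_ne z y with rfl | hzy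
  · exact hxy
  have h := swap_apply_apply (swap x y) y z
  rw [swap_apply_right, swap_apply_of_ne_of_ne hzx hzy] at h
  rw [h]
  exact H.mul_mem (H.mul_mem hxy hyz) (H.inv_mem hxy)

variable {X Y : Type*} [Fintype X] [DecidableEq X]

/-- A subset closed under an equivalence relation with classes of constant size `k` has
cardinality divisible by `k`. -/
theorem dvd_card_of_closed (R : X → X → Prop) [DecidableRel R] (hR : Equivalence R) {k : ℕ}
    (hk : ∀ x, (Finset.univ.filter (R x)).card = k) {T : Finset X}
    (hT : ∀ x ∈ T, ∀ y, R x y → y ∈ T) : k ∣ T.card := by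
  rw [Finset.card_eq_sum_card_image (fun x => Finset.univ.filter (R x)) T]
  refine Finset.dvd_sum fun C hC => ?_
  obtain ⟨x, hx, rfl⟩ := Finset.mem_image.1 hC
  rw [← hk x]
  refine dvd_of_eq (congrArg Finset.card ?_)
  ext y
  simp only [Finset.mem_filter, Finset.mem_univ, true_and, Finset.ext_iff]
  constructor
  · intro h
    exact ⟨hT x hx y h, fun z => ⟨fun h' => hR.trans h h', fun h' => hR.trans (hR.symm h) h'⟩⟩
  · rintro ⟨_, h⟩
    exact (h y).1 (hR.refl y)

/-- A transitive group of permutations that permutes the fibers of `F`, contains a transposition,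
and contains elements acting transitively on a part of a fiber of large coprime size while fixing
the rest of the fiber, contains all transpositions inside fibers. -/
theorem swap_mem_of_fiber [DecidableEq Y] {H : Subgroup (Perm X)} (F : X → Y) {d m : ℕ} (hm : 2 ≤ m)
    (hmd : m < d) (hdm : d < 2 * m) (hcop : Nat.Coprime m d)
    (htrans : ∀ x y, ∃ h ∈ H, h x = y)
    (hF : ∀ h ∈ H, ∀ x y, F x = F y → F (h x) = F (h y))
    (hfib : ∀ x, (Finset.univ.filter (fun y => F y = F x)).card = d)
    (hswap : ∃ x y, x ≠ y ∧ swap x y ∈ H)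
    (hpart : ∃ (α : Y) (S : Finset X), (∀ s ∈ S, F s = α) ∧ S.card = m ∧
      ∀ s ∈ S, ∀ s' ∈ S, ∃ h ∈ H, h s = s' ∧ ∀ t, F t = α → t ∉ S → h t = t)
    {x y : X} (hxy : F x = F y) : swap x y ∈ H := by
  classical
  let R : X → X → Prop := fun x y => swap x y ∈ H
  have hR : Equivalence R := ⟨fun x => by
    change swap x x ∈ H
    rw [swap_self]; exact H.one_mem, fun {x y} h => by
    change swap y x ∈ H
    rw [swap_comm]; exact h, swap_mem_trans⟩
  have hconj : ∀ h ∈ H, ∀ x y, R x y → R (h x) (h y) := by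
    intro h hh x y hxy
    change swap (h x) (h y) ∈ H
    rw [swap_apply_apply]
    exact H.mul_mem (H.mul_mem hh hxy) (H.inv_mem hh)
  obtain ⟨a, b, hab, hRab⟩ := hswap
  have hconst : ∀ x, (Finset.univ.filter (R x)).card = (Finset.univ.filter (R a)).card := by
    intro x
    obtain ⟨h, hh, rfl⟩ := htrans a x
    refine (Finset.card_bij (fun y _ => h y) (fun y hy => ?_) (fun y _ z _ => h.injective.eq_iff.1)
      (fun y hy => ⟨h⁻¹ y, ?_, by simp⟩)).symm
    · exact Finset.mem_filter.2 ⟨Finset.mem_univ _, hconj h hh _ _ (Finset.mem_filter.1 hy).2⟩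
    · refine Finset.mem_filter.2 ⟨Finset.mem_univ _, ?_⟩
      have := hconj h⁻¹ (H.inv_mem hh) _ _ (Finset.mem_filter.1 hy).2
      simpa using this
  generalize hk : (Finset.univ.filter (R a)).card = k at hconst
  have hk2 : 2 ≤ k := by
    rw [← hk, ← Finset.card_pair hab]
    refine Finset.card_le_card fun z hz => Finset.mem_filter.2 ⟨Finset.mem_univ _, ?_⟩
    rcases Finset.mem_insert.1 hz with rfl | hz
    · exact hR.refl _
    · rw [Finset.mem_singleton.1 hz]; exact hRab
  -- A transposition across two fibers would move x out of its fiber and fix another point z of that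
  -- fiber, although H permutes fibers.
  have hRF : ∀ x y, R x y → F x = F y := by
    intro x y h
    by_contra hne
    have hcard : 1 < (Finset.univ.filter (fun y => F y = F x)).card := by rw [hfib]; omega
    obtain ⟨z, hz, hzx⟩ := Finset.exists_mem_ne hcard x
    have hz' := (Finset.mem_filter.1 hz).2
    have hzy : z ≠ y := by
      rintro rfl
      exact hne hz'.symm
    have := hF _ h z x hz'
    rw [swap_apply_left, swap_apply_of_ne_of_ne hzx hzy, hz'] at this
    exact hne this
  obtain ⟨α, S, hSα, hSm, hSt⟩ := hpart
  by_cases hcase : ∃ s ∈ S, ∃ γ, γ ∉ S ∧ R s γ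
  · obtain ⟨s, hs, γ, hγ, hsγ⟩ := hcase
    have hFγ : F γ = α := by rw [← hRF _ _ hsγ, hSα s hs]
    have hsub : insert γ S ⊆ Finset.univ.filter (R γ) := by
      intro t ht
      refine Finset.mem_filter.2 ⟨Finset.mem_univ _, ?_⟩
      rcases Finset.mem_insert.1 ht with rfl | ht
      · exact hR.refl _
      · obtain ⟨h, hh, hst, hfix⟩ := hSt s hs t ht
        have := hconj h hh _ _ hsγ
        rw [hst, hfix γ hFγ hγ] at this
        exact hR.symm this
    have hkm : m + 1 ≤ k := by
      have := Finset.card_le_card hsub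
      rwa [Finset.card_insert_of_notMem hγ, hSm, hconst] at this
    -- A second class in the fiber would require 2k ≥ 2(m + 1) > d points.
    have hclass : Finset.univ.filter (R γ) = Finset.univ.filter (fun y => F y = F γ) := by
      refine Finset.Subset.antisymm (fun z hz => ?_) (fun z hz => ?_)
      · exact Finset.mem_filter.2 ⟨Finset.mem_univ _, (hRF _ _ (Finset.mem_filter.1 hz).2).symm⟩
      · by_contra hcon
        have hzF := (Finset.mem_filter.1 hz).2
        have hdisj : Disjoint (Finset.univ.filter (R γ)) (Finset.univ.filter (R z)) := by
          rw [Finset.disjoint_left]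
          intro w hw hw'
          exact hcon (Finset.mem_filter.2 ⟨Finset.mem_univ _,
            hR.trans (Finset.mem_filter.1 hw).2 (hR.symm (Finset.mem_filter.1 hw').2)⟩)
        have hle : (Finset.univ.filter (R γ) ∪ Finset.univ.filter (R z)).card ≤ d := by
          rw [← hfib γ]
          refine Finset.card_le_card fun w hw => Finset.mem_filter.2 ⟨Finset.mem_univ _, ?_⟩
          rcases Finset.mem_union.1 hw with hw | hw
          · exact (hRF _ _ (Finset.mem_filter.1 hw).2).symm
          · rw [← hzF]
            exact (hRF _ _ (Finset.mem_filter.1 hw).2).symm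
        rw [Finset.card_union_of_disjoint hdisj, hconst, hconst] at hle
        omega
    have hkd : k = d := by rw [← hconst γ, hclass, hfib]
    have hclass' : Finset.univ.filter (R x) = Finset.univ.filter (fun y => F y = F x) := by
      refine Finset.eq_of_subset_of_card_le (fun z hz => ?_) (by rw [hfib, hconst, hkd])
      exact Finset.mem_filter.2 ⟨Finset.mem_univ _, (hRF _ _ (Finset.mem_filter.1 hz).2).symm⟩
    have hy : y ∈ Finset.univ.filter (R x) := by
      rw [hclass']
      exact Finset.mem_filter.2 ⟨Finset.mem_univ _, hxy.symm⟩
    exact (Finset.mem_filter.1 hy).2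
  · exfalso
    push Not at hcase
    -- Here S is a union of classes, as is every fiber.
    have h1 : k ∣ m := hSm ▸ dvd_card_of_closed R hR hconst
      (fun s hs y hsy => by
        by_contra h
        exact hcase s hs y h hsy)
    have h2 : k ∣ d := hfib a ▸ dvd_card_of_closed R hR hconst
      (fun s hs y hsy => by
        rw [Finset.mem_filter] at hs ⊢
        exact ⟨Finset.mem_univ _, (hRF _ _ hsy).symm.trans hs.2⟩)
    have := Nat.eq_one_of_dvd_coprimes hcop h1 h2
    omega

/-- Induction on the support: if τ moves x, then (x τx) lies in H, and multiplying by it shrinks the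
support. -/
theorem mem_of_preserves_fibers {H : Subgroup (Perm X)} (F : X → Y)
    (hH : ∀ x y, F x = F y → swap x y ∈ H) (τ : Perm X) (hτ : ∀ x, F (τ x) = F x) : τ ∈ H := by
  generalize hn : τ.support.card = N
  induction N using Nat.strong_induction_on generalizing τ with
  | _ N ih =>
    by_cases h1 : τ = 1
    · rw [h1]; exact H.one_mem
    · obtain ⟨x, hx'⟩ : ∃ x, τ x ≠ x := by
        by_contra! h
        exact h1 (Equiv.ext h)
      have hs : swap x (τ x) ∈ H := hH _ _ (hτ x).symm
      have h2 : swap x (τ x) * τ ∈ H := by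
        refine ih _ ?_ (swap x (τ x) * τ) (fun y => ?_) rfl
        · rw [← hn]
          exact Equiv.Perm.card_support_swap_mul hx'
        · rw [Equiv.Perm.mul_apply]
          by_cases h3 : τ y = x
          · rw [h3, swap_apply_left, hτ, ← hτ y, h3]
          · by_cases h4 : τ y = τ x
            · rw [h4, swap_apply_right, ← τ.injective h4]
            · rw [swap_apply_of_ne_of_ne h3 h4, hτ]
      have h5 := H.mul_mem hs h2
      rwa [← mul_assoc, swap_mul_self, one_mul] at h5

end Perm

/-! ### The iterated wreath product as the automorphism group of the d-ary tree -/

section Wreath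

/-- Words of length `n` in `d` letters, i.e. the vertices at height `n` of the `d`-ary tree. -/
def Word (d : ℕ) : ℕ → Type
  | 0 => Unit
  | n + 1 => Fin d × Word d n

/-- Two words agree in the first `k` letters. -/
def Agree {d : ℕ} : ∀ {n : ℕ}, ℕ → Word d n → Word d n → Prop
  | 0, _, _, _ => True
  | _ + 1, 0, _, _ => True
  | _ + 1, k + 1, w, w' => w.1 = w'.1 ∧ Agree k w.2 w'.2

instance instFintypeWord (d : ℕ) : ∀ n, Fintype (Word d n)
  | 0 => inferInstanceAs (Fintype Unit)
  | n + 1 => haveI := instFintypeWord d n; inferInstanceAs (Fintype (Fin d × Word d n))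

theorem card_word (d n : ℕ) : Fintype.card (Word d n) = d ^ n := by
  induction n with
  | zero => rfl
  | succ n ih =>
    rw [pow_succ', ← ih]
    exact (Fintype.card_prod _ _).trans (by rw [Fintype.card_fin])

theorem nonempty_word {d : ℕ} (hd : 0 < d) (n : ℕ) : Nonempty (Word d n) := by
  rw [← Fintype.card_pos_iff, card_word]
  exact pow_pos hd n

/-- The action of `W ≀ S_d` on pairs. -/
def wreathStep {d : ℕ} {W Z : Type*} [Group W] (ρ : W →* Equiv.Perm Z) :
    (Fin d → W) ⋊[mulAutArrow] Equiv.Perm (Fin d) →* Equiv.Perm (Fin d × Z) where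
  -- A pair is the product of its left part after its right part: the letter is permuted first, so
  -- the component used is the one at the new letter.
  toFun g := Equiv.prodShear g.right (fun i => ρ (g.left (g.right i)))
  map_one' := by ext x <;> simp
  map_mul' g g' := by
    ext x
    · simp
    · simp only [Equiv.prodShear_apply, SemidirectProduct.mul_left, SemidirectProduct.mul_right,
        Equiv.Perm.coe_mul, Function.comp_apply, Pi.mul_apply, map_mul]
      congr 3
      change g'.left (g.right⁻¹ (g.right (g'.right x.1))) = _
      simp

/-- Preserving common prefixes characterises the permutations of leaves induced by tree
automorphisms. This intrinsic description is what the Galois image is compared with. -/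
theorem exists_wreathSym_action {d : ℕ} (hd : 0 < d) (n : ℕ) :
    ∃ ρ : wreathSym d n →* Equiv.Perm (Word d n), Function.Injective ρ ∧
      ∀ τ : Equiv.Perm (Word d n), τ ∈ ρ.range ↔
        ∀ k w w', Agree k w w' → Agree k (τ w) (τ w') := by
  induction n with
  | zero =>
    refine ⟨1, fun _ _ _ => rfl, fun τ => ⟨fun _ _ _ _ _ => trivial, fun _ => ⟨1, ?_⟩⟩⟩
    ext
    rfl
  | succ n ih =>
    obtain ⟨ρ, hinj, hrange⟩ := ih
    obtain ⟨w₀⟩ := nonempty_word hd n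
    have happ : ∀ (g : (Fin d → wreathSym d n) ⋊[mulAutArrow] Equiv.Perm (Fin d)) (i : Fin d)
        (w : Word d n), wreathStep ρ g (i, w) = (g.right i, ρ (g.left (g.right i)) w) :=
      fun _ _ _ => rfl
    refine ⟨wreathStep ρ, ?_, fun τ => ⟨?_, fun hτ => ?_⟩⟩
    · refine (injective_iff_map_eq_one (wreathStep ρ)).2 fun g hg => ?_
      have h1 : ∀ i w, (g.right i, ρ (g.left (g.right i)) w) = (i, w) := fun i w => by
        rw [← happ, hg]; rfl
      have h2 : g.right = 1 := Equiv.ext fun i => congrArg Prod.fst (h1 i w₀)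
      refine SemidirectProduct.ext (funext fun i => hinj ?_) h2
      rw [SemidirectProduct.one_left, Pi.one_apply, map_one]
      ext w
      have := congrArg Prod.snd (h1 i w)
      rwa [h2] at this
    · rintro ⟨g, rfl⟩ k w w' h
      rcases k with _ | k
      · trivial
      · obtain ⟨i, w⟩ := w
        obtain ⟨i', w'⟩ := w'
        obtain ⟨rfl, h2⟩ : i = i' ∧ Agree k w w' := h
        exact ⟨rfl, (hrange _).1 ⟨_, rfl⟩ k w w' h2⟩
    · have hfst : ∀ (i : Fin d) (w w' : Word d n), (τ (i, w)).1 = (τ (i, w')).1 := fun i w w' => by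
        have h0 : Agree (n := n + 1) 1 (i, w) (i, w') := ⟨rfl, by cases n <;> trivial⟩
        exact (hτ 1 _ _ h0).1
      have hsurj : Function.Surjective fun i : Fin d => (τ (i, w₀)).1 := fun j => by
        obtain ⟨⟨i, w⟩, h⟩ := τ.surjective ((j, w₀) : Fin d × Word d n)
        refine ⟨i, ?_⟩
        change (τ (i, w₀)).1 = j
        rw [hfst i w₀ w, h]
      let π : Equiv.Perm (Fin d) := Equiv.ofBijective _ (Finite.surjective_iff_bijective.1 hsurj)
      have hπ : ∀ i w, (τ (i, w)).1 = π i := fun i w => hfst i w w₀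
      have hinj' : ∀ i : Fin d, Function.Injective fun w : Word d n => (τ (i, w)).2 := by
        intro i w w' h
        have h2 : τ (i, w) = τ (i, w') := Prod.ext (hfst i w w') h
        exact congrArg Prod.snd (τ.injective h2)
      let τ' : Fin d → Equiv.Perm (Word d n) := fun i =>
        Equiv.ofBijective _ (Finite.injective_iff_bijective.1 (hinj' i))
      have hmem : ∀ i, τ' i ∈ ρ.range := fun i => (hrange _).2 fun k w w' h => by
        have h0 : Agree (n := n + 1) (k + 1) (i, w) (i, w') := ⟨rfl, h⟩
        exact (hτ (k + 1) _ _ h0).2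
      choose h hh using hmem
      -- Components are indexed by the target letter, hence the shift by π⁻¹.
      refine ⟨(⟨fun j => h (π⁻¹ j), π⟩ :
        (Fin d → wreathSym d n) ⋊[mulAutArrow] Equiv.Perm (Fin d)), ?_⟩
      refine Equiv.ext fun x => ?_
      obtain ⟨i, w⟩ := x
      refine Prod.ext (hπ i w).symm ?_
      change ρ (h (π⁻¹ (π i))) w = _
      rw [show π⁻¹ (π i) = i from π.symm_apply_apply i, hh]
      rfl

end Wreath

/-! ### Coding preimages by words -/

section Code

/-- The labels of the iterated images, from the root downwards. -/
def code {L : Type*} {d : ℕ} (F : L → L) (label : L → Fin d) : ∀ n, L → Word d n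
  | 0, _ => ()
  | n + 1, y => (label (F^[n] y), code F label n y)

theorem agree_refl {d : ℕ} : ∀ {n : ℕ} (k : ℕ) (w : Word d n), Agree k w w
  | 0, _, _ => trivial
  | _ + 1, 0, _ => trivial
  | _ + 1, k + 1, w => ⟨rfl, agree_refl k w.2⟩

/-- A point is determined by its image and its label, so k letters determine the ancestor at height
k. For k > n the subtraction truncates and both sides say y = y'. -/
theorem agree_code {L : Type*} {d : ℕ} {F : L → L} {label : L → Fin d}
    (hlabel : ∀ y y', F y = F y' → label y = label y' → y = y') {n : ℕ} (k : ℕ) {y y' : L}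
    (h : F^[n] y = F^[n] y') :
    Agree k (code F label n y) (code F label n y') ↔ F^[n - k] y = F^[n - k] y' := by
  induction n generalizing k with
  | zero => simpa [Agree] using h
  | succ n ih =>
    rcases k with _ | k
    · simpa [Agree] using h
    · rw [Nat.add_sub_add_right]
      have h1 : F (F^[n] y) = F (F^[n] y') := by
        rwa [← Function.iterate_succ_apply' F, ← Function.iterate_succ_apply' F]
      constructor
      · rintro ⟨h2, h3⟩
        exact (ih k (hlabel _ _ h1 h2)).1 h3
      · intro h2
        have h3 : F^[n] y = F^[n] y' := by
          by_cases hk : k ≤ n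
          · rw [show n = k + (n - k) by omega, Function.iterate_add_apply,
              Function.iterate_add_apply, h2]
          · rw [show n - k = 0 by omega] at h2
            rw [show y = y' from h2]
        exact ⟨congrArg label h3, (ih k h3).2 h2⟩

variable {L : Type*} [Field L] {d m : ℕ}

/-- A labelling of the elements of a field which separates the fibers of the trinomial map. -/
theorem exists_label (hm : 0 < m) (hmd : m < d) (b : L) :
    ∃ label : L → Fin d, ∀ y y', tri d m b y = tri d m b y' → label y = label y' → y = y' := by
  have hmem : ∀ y : L, y ∈ level d m b (tri d m b y) 1 := fun y => (mem_level hm hmd).2 rfl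
  have hemb : ∀ α : L, Nonempty (level d m b α 1 ↪ Fin d) := fun α => by
    refine Function.Embedding.nonempty_of_card_le ?_
    rw [Fintype.card_coe, Fintype.card_fin]
    simpa using card_level_le (b := b) (c := α) hm hmd 1
  let g := fun α => (hemb α).some
  refine ⟨fun y => g (tri d m b y) ⟨y, hmem y⟩, fun y y' h h' => ?_⟩
  have key : ∀ (α : L) (hα : tri d m b y' = α),
      g (tri d m b y') ⟨y', hmem y'⟩ = g α ⟨y', hα ▸ hmem y'⟩ := by
    rintro α rfl
    rfl
  have h'' : g (tri d m b y) ⟨y, hmem y⟩ = g (tri d m b y') ⟨y', hmem y'⟩ := h'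
  rw [key _ h.symm] at h''
  exact congrArg Subtype.val ((g _).injective h'')

end Code

/-! ### From fiber transpositions to all tree automorphisms -/

section Tower

variable {K L : Type*} [Field K] [Field L] [Algebra K L] {d m : ℕ}

theorem iterate_apply_tri {b : K} (σ : Gal(L/K)) (k : ℕ) (y : L) :
    (tri d m (algebraMap K L b))^[k] (σ y) = σ ((tri d m (algebraMap K L b))^[k] y) := by
  have := map_tri_iterate σ d m (algebraMap K L b) y k
  rw [AlgEquiv.commutes] at this
  exact this.symm

/-- The permutation of the `n`-th preimages defined by an automorphism. -/
def levelPerm (hm : 0 < m) (hmd : m < d) (b x₀ : K) (n : ℕ) :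
    Gal(L/K) →* Equiv.Perm (level d m (algebraMap K L b) (algebraMap K L x₀) n) where
  toFun σ :=
    { toFun y := ⟨σ y, apply_mem_level hm hmd σ y.2⟩
      invFun y := ⟨σ⁻¹ y, apply_mem_level hm hmd σ⁻¹ y.2⟩
      left_inv _ := Subtype.ext (σ.symm_apply_apply _)
      right_inv _ := Subtype.ext (σ.apply_symm_apply _) }
  map_one' := rfl
  map_mul' _ _ := rfl

theorem coe_levelPerm (hm : 0 < m) (hmd : m < d) (b x₀ : K) (n : ℕ) (σ : Gal(L/K))
    (y : level d m (algebraMap K L b) (algebraMap K L x₀) n) :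
    (levelPerm hm hmd b x₀ n σ y : L) = σ y := rfl

/-- If the Galois group contains all transpositions inside the fibers at each level, then it
contains all automorphisms of the tree of preimages. -/
theorem exists_galois_of_tree_perm [DecidableEq L] (hm : 0 < m) (hmd : m < d) (b x₀ : K) {N : ℕ}
    (hcard : ∀ i ≤ N, (level d m (algebraMap K L b) (algebraMap K L x₀) i).card = d ^ i)
    (hswap : ∀ n < N, ∀ x y : level d m (algebraMap K L b) (algebraMap K L x₀) (n + 1),
      tri d m (algebraMap K L b) x = tri d m (algebraMap K L b) y →
        Equiv.swap x y ∈ (levelPerm (L := L) hm hmd b x₀ (n + 1)).range)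
    {n : ℕ} (hn : n ≤ N)
    (τ : Equiv.Perm (level d m (algebraMap K L b) (algebraMap K L x₀) n))
    (hτ : ∀ k ≤ n, ∀ x y : level d m (algebraMap K L b) (algebraMap K L x₀) n, (tri d m (algebraMap K L b))^[k] x = (tri d m (algebraMap K L b))^[k] y →
      (tri d m (algebraMap K L b))^[k] (τ x) = (tri d m (algebraMap K L b))^[k] (τ y)) :
    ∃ σ : Gal(L/K), levelPerm hm hmd b x₀ n σ = τ := by
  induction n with
  | zero =>
    refine ⟨1, Equiv.ext fun x => Subtype.ext ?_⟩
    have h1 := (mem_level hm hmd).1 x.2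
    have h2 := (mem_level hm hmd).1 (τ x).2
    exact h1.trans h2.symm
  | succ n ih =>
    let F : level d m (algebraMap K L b) (algebraMap K L x₀) (n + 1) → level d m (algebraMap K L b) (algebraMap K L x₀) n := fun y =>
      ⟨tri d m (algebraMap K L b) y, (mem_level_succ hm hmd).1 y.2⟩
    have hFsurj : Function.Surjective F := fun α => by
      have h1 := card_fiber_eq hm hmd (hcard n (by omega)) (hcard (n + 1) hn) α.2
      obtain ⟨y, hy⟩ := Finset.card_pos.1 (h1.symm ▸ (by omega : 0 < d))
      have h2 : tri d m (algebraMap K L b) y = α := (mem_level (n := 1) hm hmd).1 hy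
      exact ⟨⟨y, (mem_level_succ hm hmd).2 (h2.symm ▸ α.2)⟩, Subtype.ext h2⟩
    have hτF : ∀ x y, F x = F y → F (τ x) = F (τ y) := fun x y h =>
      Subtype.ext (hτ 1 (by omega) x y (congrArg Subtype.val h))
    -- τ respects the fibers of F, so it descends to level n; the section g computes the descended
    -- map, independently of its choice.
    choose g hg using hFsurj
    have hbarF : ∀ y, F (τ (g (F y))) = F (τ y) := fun y => hτF _ _ (hg _)
    have hsurj : Function.Surjective fun α => F (τ (g α)) := fun α => by
      refine ⟨F (τ.symm (g α)), ?_⟩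
      change F (τ (g (F _))) = α
      rw [hbarF, Equiv.apply_symm_apply, hg]
    obtain ⟨σ, hσ⟩ := ih (by omega)
      (Equiv.ofBijective _ (Finite.surjective_iff_bijective.1 hsurj)) (fun k hk x y hxy => by
        have := hτ (k + 1) (by omega) (g x) (g y) (by
          rw [Function.iterate_succ_apply, Function.iterate_succ_apply,
            show tri d m (algebraMap K L b) (g x) = x from congrArg Subtype.val (hg x),
            show tri d m (algebraMap K L b) (g y) = y from congrArg Subtype.val (hg y), hxy])
        rwa [Function.iterate_succ_apply, Function.iterate_succ_apply] at this)
    have hσF : ∀ y, F (levelPerm hm hmd b x₀ (n + 1) σ y) = F (τ y) := fun y => by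
      have h1 := congrArg (fun π => π (F y)) hσ
      rw [← hbarF]
      refine Eq.trans (Subtype.ext ?_) h1
      exact (apply_tri σ (y : L)).symm
    -- σ⁻¹τ induces the identity on level n, hence preserves every fiber.
    obtain ⟨ρ, hρ⟩ := mem_of_preserves_fibers F
      (fun x y h => hswap n (by omega) x y (congrArg Subtype.val h))
      ((levelPerm hm hmd b x₀ (n + 1) σ)⁻¹ * τ) (fun y => by
        refine Subtype.ext (σ.injective ?_)
        have h2 : tri d m (algebraMap K L b) (σ y) = tri d m (algebraMap K L b) (τ y) := congrArg Subtype.val (hσF y)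
        change σ (tri d m (algebraMap K L b) (σ⁻¹ (τ y))) = σ (tri d m (algebraMap K L b) y)
        rw [apply_tri, apply_tri, h2]
        exact congrArg _ (σ.apply_symm_apply _))
    exact ⟨σ * ρ, by rw [map_mul, hρ, mul_inv_cancel_left]⟩

end Tower

/-! ### Assembling the isomorphism with the wreath product -/

section Main

variable {K L : Type*} [Field K] [Field L] [Algebra K L] {d m : ℕ}

/-- Faithful Galois groups containing all tree automorphisms are iterated wreath products. -/
theorem nonempty_mulEquiv_wreathSym [DecidableEq L] (hm : 0 < m) (hmd : m < d) (b x₀ : K) {n : ℕ}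
    (hcard : ∀ i ≤ n, (level d m (algebraMap K L b) (algebraMap K L x₀) i).card = d ^ i)
    (hswap : ∀ i < n, ∀ x y : level d m (algebraMap K L b) (algebraMap K L x₀) (i + 1),
      tri d m (algebraMap K L b) x = tri d m (algebraMap K L b) y →
        Equiv.swap x y ∈ (levelPerm (L := L) hm hmd b x₀ (i + 1)).range)
    (hfaithful : ∀ σ : Gal(L/K),
      (∀ y ∈ level d m (algebraMap K L b) (algebraMap K L x₀) n, σ y = y) → σ = 1) :
    Nonempty (Gal(L/K) ≃* wreathSym d n) := by
  obtain ⟨label, hlabel⟩ := exists_label hm hmd (algebraMap K L b)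
  obtain ⟨ρ, hρ, hrange⟩ := exists_wreathSym_action (by omega : 0 < d) n
  have hagree : ∀ (k : ℕ) (x y : level d m (algebraMap K L b) (algebraMap K L x₀) n),
      Agree k (code (tri d m (algebraMap K L b)) label n x)
        (code (tri d m (algebraMap K L b)) label n y) ↔
      (tri d m (algebraMap K L b))^[n - k] x = (tri d m (algebraMap K L b))^[n - k] y :=
    fun k x y => agree_code hlabel k
      (((mem_level hm hmd).1 x.2).trans ((mem_level hm hmd).1 y.2).symm)
  have hinj : Function.Injective fun y : level d m (algebraMap K L b) (algebraMap K L x₀) n =>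
      code (tri d m (algebraMap K L b)) label n y := fun x y h => by
    have h' : code (tri d m (algebraMap K L b)) label n x =
      code (tri d m (algebraMap K L b)) label n y := h
    have := (hagree n x y).1 (by rw [h']; exact agree_refl _ _)
    rw [Nat.sub_self] at this
    exact Subtype.ext this
  let e : level d m (algebraMap K L b) (algebraMap K L x₀) n ≃ Word d n :=
    Equiv.ofBijective _ ((Fintype.bijective_iff_injective_and_card _).2
      ⟨hinj, by rw [Fintype.card_coe, hcard n le_rfl, card_word]⟩)
  have he : ∀ y, e y = code (tri d m (algebraMap K L b)) label n y := fun _ => rfl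
  let Ψ : Gal(L/K) →* Equiv.Perm (Word d n) :=
    (e.permCongrHom : _ →* Equiv.Perm (Word d n)).comp (levelPerm hm hmd b x₀ n)
  have hΨ : ∀ σ y, Ψ σ (e y) = e (levelPerm hm hmd b x₀ n σ y) := fun σ y => by
    change e (levelPerm hm hmd b x₀ n σ (e.symm (e y))) = _
    rw [e.symm_apply_apply]
  have hΨinj : Function.Injective Ψ := (injective_iff_map_eq_one Ψ).2 fun σ hσ => by
    refine hfaithful σ fun y hy => ?_
    have := hΨ σ ⟨y, hy⟩
    rw [hσ] at this
    exact (congrArg Subtype.val (e.injective this)).symm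
  -- Both images are the group of prefix-preserving permutations of words.
  have hΨrange : Ψ.range = ρ.range := by
    ext τ
    rw [hrange]
    constructor
    · rintro ⟨σ, rfl⟩ k w w' h
      obtain ⟨x, rfl⟩ := e.surjective w
      obtain ⟨y, rfl⟩ := e.surjective w'
      rw [hΨ, hΨ, he, he, hagree, coe_levelPerm, coe_levelPerm, iterate_apply_tri,
        iterate_apply_tri, (hagree k x y).1 h]
    · intro hτ
      obtain ⟨σ, hσ⟩ := exists_galois_of_tree_perm hm hmd b x₀ hcard hswap le_rfl
        (e.symm.permCongr τ) (fun k hk x y hxy => by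
          have h1 : ∀ x, e (e.symm.permCongr τ x) = τ (e x) := fun x => by
            simp [Equiv.permCongr_apply]
          have h2 := hτ (n - k) (e x) (e y) ((hagree (n - k) x y).2 (by
            rwa [show n - (n - k) = k by omega]))
          rw [← h1, ← h1, he, he, hagree, show n - (n - k) = k by omega] at h2
          exact h2)
      refine ⟨σ, Equiv.ext fun w => ?_⟩
      obtain ⟨x, rfl⟩ := e.surjective w
      rw [hΨ, hσ]
      simp [Equiv.permCongr_apply]
  exact ⟨(MonoidHom.ofInjective hΨinj).trans
    ((MulEquiv.subgroupCongr hΨrange).trans (MonoidHom.ofInjective hρ).symm)⟩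

theorem swap_mem_range_levelPerm [DecidableEq L] (hm : 2 ≤ m) (hmd : m < d) (hdm : d < 2 * m)
    (hcop : Nat.Coprime m d) {b x₀ : K} {n : ℕ}
    (hcard : ∀ i ≤ n + 1, (level d m (algebraMap K L b) (algebraMap K L x₀) i).card = d ^ i)
    (htrans : ∀ y ∈ level d m (algebraMap K L b) (algebraMap K L x₀) (n + 1),
      ∀ y' ∈ level d m (algebraMap K L b) (algebraMap K L x₀) (n + 1), ∃ σ : Gal(L/K), σ y = y')
    (hpart : ∃ α ∈ level d m (algebraMap K L b) (algebraMap K L x₀) n,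
      ∃ S ⊆ level d m (algebraMap K L b) α 1, S.card = m ∧
        ∀ s ∈ S, ∀ s' ∈ S, ∃ σ : Gal(L/K), σ s = s' ∧
          ∀ t ∈ level d m (algebraMap K L b) α 1, t ∉ S → σ t = t)
    (hswap : ∃ β₁ ∈ level d m (algebraMap K L b) (algebraMap K L x₀) (n + 1),
      ∃ β₂ ∈ level d m (algebraMap K L b) (algebraMap K L x₀) (n + 1), β₁ ≠ β₂ ∧
      ∃ σ : Gal(L/K), σ β₁ = β₂ ∧ σ β₂ = β₁ ∧
        ∀ t ∈ level d m (algebraMap K L b) (algebraMap K L x₀) (n + 1),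
          t ≠ β₁ → t ≠ β₂ → σ t = t)
    (x y : level d m (algebraMap K L b) (algebraMap K L x₀) (n + 1))
    (hxy : tri d m (algebraMap K L b) (x : L) = tri d m (algebraMap K L b) y) :
    Equiv.swap x y ∈
      (levelPerm (L := L) (by omega : 0 < m) hmd b x₀ (n + 1)).range := by
  have hm0 : 0 < m := by omega
  refine swap_mem_of_fiber
    (fun z : level d m (algebraMap K L b) (algebraMap K L x₀) (n + 1) =>
      tri d m (algebraMap K L b) (z : L)) hm hmd hdm hcop ?_ ?_ ?_ ?_ ?_ hxy
  · intro x y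
    obtain ⟨σ, hσ⟩ := htrans x x.2 y y.2
    exact ⟨_, ⟨σ, rfl⟩, Subtype.ext hσ⟩
  · rintro _ ⟨σ, rfl⟩ x y h
    rw [coe_levelPerm, coe_levelPerm, ← apply_tri, ← apply_tri, h]
  · intro x
    refine Eq.trans ?_ (card_fiber_eq hm0 hmd (hcard n (by omega)) (hcard (n + 1) le_rfl)
      ((mem_level_succ hm0 hmd).1 x.2))
    rw [← Finset.card_map (Function.Embedding.subtype _)]
    congr 1
    ext z
    simp only [Finset.mem_map, Finset.mem_filter, Finset.mem_univ, true_and,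
      Function.Embedding.subtype_apply]
    rw [mem_level hm0 hmd]
    constructor
    · rintro ⟨z, hz, rfl⟩
      exact hz
    · intro hz
      have hz' : tri d m (algebraMap K L b) z = tri d m (algebraMap K L b) x := hz
      exact ⟨⟨z, (mem_level_succ hm0 hmd).2
        (by rw [hz']; exact (mem_level_succ hm0 hmd).1 x.2)⟩, hz', rfl⟩
  · obtain ⟨β₁, h₁, β₂, h₂, hne, σ, hσ₁, hσ₂, hσ⟩ := hswap
    refine ⟨⟨β₁, h₁⟩, ⟨β₂, h₂⟩, fun h => hne (congrArg Subtype.val h), σ, Equiv.ext fun t => ?_⟩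
    by_cases ht₁ : t = ⟨β₁, h₁⟩
    · rw [ht₁, Equiv.swap_apply_left]
      exact Subtype.ext hσ₁
    by_cases ht₂ : t = ⟨β₂, h₂⟩
    · rw [ht₂, Equiv.swap_apply_right]
      exact Subtype.ext hσ₂
    rw [Equiv.swap_apply_of_ne_of_ne ht₁ ht₂]
    exact Subtype.ext (hσ t t.2 (fun h => ht₁ (Subtype.ext h)) (fun h => ht₂ (Subtype.ext h)))
  · obtain ⟨α, hα, S, hS, hSm, hSσ⟩ := hpart
    have hSα : ∀ s ∈ S, tri d m (algebraMap K L b) s = α := fun s hs =>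
      (mem_level (n := 1) hm0 hmd).1 (hS hs)
    have hSlevel : ∀ s ∈ S, s ∈ level d m (algebraMap K L b) (algebraMap K L x₀) (n + 1) :=
      fun s hs => (mem_level_succ hm0 hmd).2 ((hSα s hs).symm ▸ hα)
    refine ⟨α, Finset.subtype
      (· ∈ level d m (algebraMap K L b) (algebraMap K L x₀) (n + 1)) S, ?_, ?_, ?_⟩
    · exact fun s hs => hSα s (Finset.mem_subtype.1 hs)
    · rw [Finset.card_subtype, Finset.filter_true_of_mem hSlevel, hSm]
    · intro s hs s' hs'
      obtain ⟨σ, hσ, hfix⟩ := hSσ s (Finset.mem_subtype.1 hs) s' (Finset.mem_subtype.1 hs')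
      refine ⟨_, ⟨σ, rfl⟩, Subtype.ext hσ, fun t ht htS => Subtype.ext (hfix t ?_ ?_)⟩
      · exact (mem_level (n := 1) hm0 hmd).2 ht
      · exact fun h => htS (Finset.mem_subtype.2 h)

end Main

/-! ### The preimage field as a splitting field -/

section PreimageField

variable {K : Type*} [Field K]

theorem preimageField_eq_adjoin_rootSet (f : K[X]) (x₀ : K) (n : ℕ) (hne : iter f n - C x₀ ≠ 0) :
    preimageField f x₀ n =
      IntermediateField.adjoin K ((iter f n - C x₀).rootSet (AlgebraicClosure K)) := by
  unfold preimageField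
  congr 1
  ext α
  rw [mem_rootSet_of_ne hne, map_sub, aeval_C, sub_eq_zero]
  rfl

theorem isSplittingField_preimageField (f : K[X]) (x₀ : K) (n : ℕ) (hne : iter f n - C x₀ ≠ 0) :
    (iter f n - C x₀).IsSplittingField K (preimageField f x₀ n) := by
  rw [preimageField_eq_adjoin_rootSet f x₀ n hne]
  exact IntermediateField.adjoin_rootSet_isSplittingField (IsAlgClosed.splits _)

end PreimageField

theorem valuation_eq_one_of_notMem {K : Type*} [Field K] [NumberField K]
    (p : HeightOneSpectrum (𝓞 K)) {x : 𝓞 K} (hx : x ∉ p.asIdeal) : p.valuation K (x : K) = 1 :=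
  le_antisymm (p.valuation_le_one x) (not_lt.1 fun h =>
    hx ((HeightOneSpectrum.valuation_lt_one_iff_mem _ _).1 h))

end Arboreal

open Arboreal

theorem theorem3p1 {K : Type*} [Field K] [NumberField K]
    (d m : ℕ) (hm : 2 ≤ m) (hmd : m < d) (hcop : Nat.Coprime m d) (hhalf : (d : ℚ) / 2 < m)
    (b x₀ : K) (s t u w : 𝓞 K) (ht : t ≠ 0) (hw : w ≠ 0)
    (hx₀ : x₀ = (s : K) / (t : K)) (hb : b = (u : K) / (w : K))
    (hst : IsCoprime s t) (huw : IsCoprime u w)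
    (f : K[X]) (hf : f = X ^ d - C b * X ^ m)
    -- condition (1)
    (h1 : ∃ p₁ : IsDedekindDomain.HeightOneSpectrum (𝓞 K),
      1 ≤ Arboreal.ord p₁ b ∧ Arboreal.ord p₁ x₀ = 1)
    -- condition (2)
    (h2 : ∃ p₂ : IsDedekindDomain.HeightOneSpectrum (𝓞 K),
      ((d : 𝓞 K) - (m : 𝓞 K)) ∉ p₂.asIdeal ∧
      Arboreal.ord p₂ b < min (Arboreal.ord p₂ x₀) 0 ∧
      (∃ k : ℤ, Arboreal.ord p₂ b = (k : WithTop ℤ) ∧ ((d : ℤ) - (m : ℤ)) ∣ k) ∧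
      (∃ k : ℤ, Arboreal.ord p₂ (x₀ / b) = (k : WithTop ℤ) ∧ Int.gcd (m : ℤ) k = 1))
    -- condition (3)
    (h3 : ∀ n : ℕ, 1 ≤ n → ∃ p : IsDedekindDomain.HeightOneSpectrum (𝓞 K),
      s * t * u * w * (d : 𝓞 K) * ((d : 𝓞 K) - (m : 𝓞 K)) ∉ p.asIdeal ∧
      (∃ k : ℤ, Arboreal.ord p (Arboreal.iter f n - C x₀).discr = (k : WithTop ℤ) ∧
        0 < k ∧ Odd k) ∧
      ∀ l : ℕ, l < n → Arboreal.ord p (Arboreal.iter f l - C x₀).discr = 0) :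
    ∀ n : ℕ, Nonempty
      ((Arboreal.preimageField f x₀ n ≃ₐ[K] Arboreal.preimageField f x₀ n) ≃*
        Arboreal.wreathSym d n) := by
  classical
  intro n
  subst hf
  have hm0 : 0 < m := by omega
  have hdm : d < 2 * m := by
    have : (d : ℚ) < 2 * m := by linarith
    exact_mod_cast this
  obtain ⟨hmon, hdeg⟩ := trinomial_monic' hmd hm0 b
  obtain ⟨hmon', hdeg'⟩ := iter_sub_C_monic hmon (by omega) n x₀
  rw [hdeg] at hdeg'
  have hsplit := isSplittingField_preimageField (X ^ d - C b * X ^ m) x₀ n hmon'.ne_zero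
  have hfin := IsSplittingField.finiteDimensional (preimageField (X ^ d - C b * X ^ m) x₀ n)
    (iter (X ^ d - C b * X ^ m) n - C x₀)
  have hnormal := Normal.of_isSplittingField (E := preimageField (X ^ d - C b * X ^ m) x₀ n)
    (iter (X ^ d - C b * X ^ m) n - C x₀)
  generalize hL : preimageField (X ^ d - C b * X ^ m) x₀ n = L at *
  have : NumberField L := NumberField.of_module_finite K L
  have : IsGalois K L := {}
  -- One root suffices: its forward images make every lower level nonempty, and the Eisenstein prime
  -- then gives full cardinality and transitivity.
  obtain ⟨y, hy⟩ : ∃ y : L, (tri d m (algebraMap K L b))^[n] y = algebraMap K L x₀ := by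
    have := hsplit.splits
    obtain ⟨y, hy⟩ := this.exists_eval_eq_zero (by
      rw [degree_map]
      exact (natDegree_pos_iff_degree_pos.1 (by rw [hdeg']; exact pow_pos (by omega) _)).ne')
    refine ⟨y, ?_⟩
    rw [eval_map_algebraMap, map_sub, aeval_trinomial_iter, aeval_C] at hy
    exact sub_eq_zero.1 hy
  obtain ⟨p₁, h1b, h1x⟩ := h1
  have hlevel : ∀ i ≤ n, (level d m (algebraMap K L b) (algebraMap K L x₀) i).card = d ^ i ∧
      ∀ y ∈ level d m (algebraMap K L b) (algebraMap K L x₀) i,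
      ∀ y' ∈ level d m (algebraMap K L b) (algebraMap K L x₀) i, ∃ σ : Gal(L/K), σ y = y' := by
    intro i hi
    refine level_transitive hm0 hmd p₁ ((one_le_ord_iff p₁).1 h1b)
      ((ord_eq_coe_iff p₁ (k := 1)).1 h1x) (y₀ := (tri d m (algebraMap K L b))^[n - i] y) ?_
    rw [mem_level hm0 hmd, ← Function.iterate_add_apply, show i + (n - i) = n by omega, hy]
  refine nonempty_mulEquiv_wreathSym hm0 hmd b x₀ (fun i hi => (hlevel i hi).1) ?_ ?_
  · intro i hi
    have hcard : ∀ j ≤ i + 1, (level d m (algebraMap K L b) (algebraMap K L x₀) j).card = d ^ j :=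
      fun j hj => (hlevel j (by omega)).1
    refine swap_mem_range_levelPerm hm hmd hdm hcop hcard (hlevel (i + 1) hi).2 ?_ ?_
    · obtain ⟨p₂, hp, hlt, ⟨k, hk, j, rfl⟩, ⟨l, hl, hgcd⟩⟩ := h2
      obtain ⟨hlt1, hlt2⟩ := lt_min_iff.1 hlt
      refine exists_transitive_on_part hm hmd p₂ ?_ ((ord_eq_coe_iff p₂).1 hk)
        ((ord_neg_iff p₂).1 hlt2) ((ord_lt_ord_iff p₂).1 hlt1) ((ord_eq_coe_iff p₂).1 hl)
        (Int.isCoprime_iff_gcd_eq_one.2 hgcd) hcard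
      simpa using valuation_eq_one_of_notMem p₂ hp
    · obtain ⟨p, hp, ⟨k, hk, -, hodd⟩, hlow⟩ := h3 (i + 1) (by omega)
      have hdvd : ∀ x : 𝓞 K, x ∣ s * t * u * w * (d : 𝓞 K) * ((d : 𝓞 K) - (m : 𝓞 K)) →
          p.valuation K (x : K) = 1 := fun x hx =>
        valuation_eq_one_of_notMem p fun h => hp (p.asIdeal.mem_of_dvd hx h)
      refine exists_transposition hm hmd hcop p ?_ ?_ ?_ ?_
        ((ord_eq_zero_iff p).1 (hlow i (by omega))) ((ord_eq_coe_iff p).1 hk) hodd hcard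
      · rw [hb, map_div₀, hdvd u ⟨s * t * w * d * (d - m), by ring⟩,
          hdvd w ⟨s * t * u * d * (d - m), by ring⟩, div_one]
      · rw [hx₀, map_div₀, hdvd s ⟨t * u * w * d * (d - m), by ring⟩,
          hdvd t ⟨s * u * w * d * (d - m), by ring⟩, div_one]
      · simpa using hdvd d ⟨s * t * u * w * (d - m), by ring⟩
      · simpa using hdvd (d - m) ⟨s * t * u * w * d, by ring⟩
  · intro σ hσ
    -- Faithfulness: L is generated by the level-n points, so an automorphism fixing them is
    -- trivial.
    have hadj : L = IntermediateField.adjoin K (preimages (X ^ d - C b * X ^ m) x₀ n) := hL.symm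
    refine AlgEquiv.coe_toAlgHom_injective
      (IntermediateField.algHom_ext_of_eq_adjoin K hadj fun α hα => ?_)
    refine hσ _ ((mem_level hm0 hmd).2 (Subtype.ext ?_))
    have h4 : aeval α (iter (X ^ d - C b * X ^ m) n) = algebraMap K (AlgebraicClosure K) x₀ := hα
    rw [aeval_trinomial_iter] at h4
    exact (map_tri_iterate L.val d m (algebraMap K L b) _ n).trans h4
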